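/- Let $p$ be an odd prime, $\mathbb F_p=\mathbb Z/p\mathbb Z$, $\xi(a)=e^{2\pi i a/p}$, and let $\mathcal H_p=\mathbb C^p$ have basis $|x\rangle$, $x\in\mathbb F_p$, with Pauli operators $X|x\rangle=|x+1\rangle$, $Z|x\rangle=\xi(x)|x\rangle$. For $a\in\mathbb F_p$ and $v=(x,z)\in\mathbb F_p^{2n}$ put $\pi(a,v)=\xi(a+\tfrac12 z^{T}x)\bigotimes_k X^{x_k}Z^{z_k}$; these operators form the $n$-qupit Pauli group. Let $\omega_n((x,z),(x',z'))=x^{T}z'-z^{T}x'$. $\mathsf{Stab}_p$ is the dagger-compact-closed subcategory of finite-dimensional Hilbert spaces, with objects $\mathcal H_p^{\otimes n}$ ($n\ge 0$), generated under tensor product, composition and adjoint by the stabiliser states (unit vectors, of any phase, fixed by a maximal one among the abelian groups of Pauli operators whose only scalar element is $1$), the Clifford operators (unitaries normalising the Pauli group) and the scalars $\sqrt p$, $1/\sqrt p$. $\mathrm{CPM}(\mathsf{Stab}_p)$ has the same objects; its morphisms $X\to Y$ are classes $[f,S]$ of maps $f:X\otimes S\to Y$ of $\mathsf{Stab}_p$,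 two pairs being identified when they induce the same completely positive map $\rho\mapsto f(\rho\otimes 1_S)f^\dagger$. $\mathrm{Proj}(\mathrm{CPM}(\mathsf{Stab}_p))$ is its quotient by invertible scalars, and $\mathrm{Caus}(\mathrm{CPM}(\mathsf{Stab}_p))$ is its subcategory of causal (trace-preserving) morphisms. An affine coisotropic relation $\mathbb F_p^{2n}\to\mathbb F_p^{2m}$ is a possibly empty affine subspace of $(\mathbb F_p^{2n}\oplus\mathbb F_p^{2m},-\omega_n\oplus\omega_m)$ which, if non-empty, has a linear component containing its symplectic complement. Its name is its image in $(\mathbb F_p^{2(n+m)},\omega_{n+m})$ under $((x,z),(x',z'))\mapsto((x,x'),(-z,z'))$. For a non-empty affine coisotropic subspace $C=L+a\subseteq\mathbb F_p^{2k}$ let $G_C=\{\pi(\omega_k(a,b),b): b\in L^{\omega}\}$ and $\Pi_{G_C}=|G_C|^{-1}\sum_{P\in G_C}P$; let $\Pi_{G_\emptyset}=0$. For a morphism $f:\mathcal H_p^{\otimes n}\to\mathcal H_p^{\otimes m}$ of $\mathrm{CPM}(\mathsf{Stab}_p)$, let $J(f)=\sum_{x,x'}|x\rangle\langle x'|\otimes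 f(|x\rangle\langle x'|)$ be its Choi matrix, let $\mathrm{rel}(f)$ be the relation whose name is $\{v : t=\omega_{n+m}(v,b)\text{ for all }(t,b)\text{ with }\pi(t,b)J(f)=J(f)\}$, and let $\Pi_f=\Pi_{G_C}$, where $C$ is the name of $\mathrm{rel}(f)$. Both $\mathrm{rel}(f)$ and $\Pi_f$ are unchanged when $f$ is multiplied by an invertible scalar. **Theorem.** For every morphism $f$ of $\mathrm{CPM}(\mathsf{Stab}_p)$, $\mathrm{rel}(f)$ is an affine coisotropic relation and $J(f)=c\,\Pi_f$ for some real $c>0$. For parallel morphisms write $f\preceq g$ when $\Pi_f\preceq\Pi_g$ in the Löwner order, i.e. when $\Pi_g-\Pi_f$ is positive semidefinite. Then in each of the three categories below, $f\preceq g$ if and only if $\mathrm{rel}(f)\subseteq\mathrm{rel}(g)$, and: 1. $\preceq$ makes $\mathrm{CPM}(\mathsf{Stab}_p)$ a category enriched in preordered sets, i.e. it is a preorder on every hom-set and composition is monotone; 2. $\preceq$ makes $\mathrm{Proj}(\mathrm{CPM}(\mathsf{Stab}_p))$ a category enriched in partially ordered sets; 3. $\preceq$ makes $\mathrm{Caus}(\mathrm{CPM}(\mathsf{Stab}_p))$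 a category enriched in partially ordered sets. -/

import Mathlib

open CategoryTheory
open scoped Matrix Kronecker MatrixOrder

noncomputable section

namespace StabTheory

/-! ## Registers, phase space and Pauli operators -/

/-- Labels of the computational basis of `n` qupits, so that the Hilbert space of `n` qupits
is the space of functions `Reg p n → ℂ`. -/
abbrev Reg (p n : ℕ) : Type := Fin n → ZMod p

/-- The space `𝔽_p^{2n}` of pairs `(x, z)`. -/
abbrev Phase (p n : ℕ) : Type := (Fin n → ZMod p) × (Fin n → ZMod p)

/-- The standard symplectic form `ω_n((x, z), (x', z')) = xᵀ z' - zᵀ x'`. -/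
def symp {p n : ℕ} (v w : Phase p n) : ZMod p := v.1 ⬝ᵥ w.2 - v.2 ⬝ᵥ w.1

variable {p : ℕ} [Fact p.Prime]

/-- The Pauli operator `π(a, x, z) = ξ(a + zᵀx / 2) ⨂ₖ X^{xₖ} Z^{zₖ}`, which sends the basis
vector `|j⟩` to `ξ(a + zᵀx / 2) ξ(zᵀj) |j + x⟩`; here `ξ(a) = exp (2 π i a / p)`. -/
def pauli {n : ℕ} (a : ZMod p) (v : Phase p n) : Matrix (Reg p n) (Reg p n) ℂ :=
  Matrix.of fun i j =>
    if i = j + v.1 then ZMod.stdAddChar (a + 2⁻¹ * (v.2 ⬝ᵥ v.1) + v.2 ⬝ᵥ j) else 0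

/-- The `n`-qupit Pauli group, as a set of operators. -/
def pauliSet (p n : ℕ) [Fact p.Prime] : Set (Matrix (Reg p n) (Reg p n) ℂ) :=
  {P | ∃ (a : ZMod p) (v : Phase p n), P = pauli a v}

/-! ## Pure stabiliser maps -/

/-- The Clifford group: the unitary normaliser of the Pauli group. -/
def IsClifford {n : ℕ} (U : Matrix (Reg p n) (Reg p n) ℂ) : Prop :=
  U ∈ Matrix.unitaryGroup (Reg p n) ℂ ∧ ∀ P ∈ pauliSet p n, U * P * Uᴴ ∈ pauliSet p n

/-- An abelian group of Pauli operators whose only scalar element is the identity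
(a stabiliser code). -/
def IsStabiliserCode {n : ℕ} (S : Subgroup (Matrix.unitaryGroup (Reg p n) ℂ)) : Prop :=
  (∀ U ∈ S, (U : Matrix (Reg p n) (Reg p n) ℂ) ∈ pauliSet p n) ∧
  (∀ U ∈ S, ∀ V ∈ S, U * V = V * U) ∧
  ∀ a : ZMod p, (∃ U ∈ S, (U : Matrix (Reg p n) (Reg p n) ℂ) = ZMod.stdAddChar a • 1) ↔ a = 0

/-- A stabiliser group is a maximal stabiliser code. -/
def IsStabiliserGroup {n : ℕ} (S : Subgroup (Matrix.unitaryGroup (Reg p n) ℂ)) : Prop :=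
  Maximal IsStabiliserCode S

/-- A stabiliser state: a normalised vector (any phase is allowed) that is fixed by a
stabiliser group. -/
def IsStabiliserState {n : ℕ} (ψ : Reg p n → ℂ) : Prop :=
  ∑ i, ‖ψ i‖ ^ 2 = 1 ∧ ∃ S : Subgroup (Matrix.unitaryGroup (Reg p n) ℂ),
    IsStabiliserGroup S ∧ ∀ U ∈ S, (U : Matrix (Reg p n) (Reg p n) ℂ) *ᵥ ψ = ψ

/-- The tensor product of linear maps between qupit systems, with the basis of the joint system
labelled by concatenation. -/
def tensor {n m n' m' : ℕ} (A : Matrix (Reg p m) (Reg p n) ℂ)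
    (B : Matrix (Reg p m') (Reg p n') ℂ) : Matrix (Reg p (m + m')) (Reg p (n + n')) ℂ :=
  (A ⊗ₖ B).reindex (Fin.appendEquiv m m') (Fin.appendEquiv n n')

/-- The cup `∑ⱼ |j⟩ ⊗ |j⟩ : I → n ⊗ n*`, the dual system being identified with the system itself
by means of the computational basis. -/
def cup (p n : ℕ) : Matrix (Reg p (n + n)) (Reg p 0) ℂ :=
  Matrix.of fun u _ => if u ∘ Fin.castAdd n = u ∘ Fin.natAdd n then 1 else 0

/-- The morphisms `n ⟶ m` of `Stab_p`: the dagger-compact-closed subcategory of finite-dimensional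
Hilbert spaces on the spaces of `n` qupits that is generated by the stabiliser states, the Clifford
operators and the scalars `√p`, `1/√p` under tensor product, composition and adjoint.
Identities and symmetries are Clifford operators. -/
inductive IsStab : {n m : ℕ} → Matrix (Reg p m) (Reg p n) ℂ → Prop
  | state {n : ℕ} (ψ : Reg p n → ℂ) (h : IsStabiliserState ψ) :
      IsStab (n := 0) (m := n) (Matrix.of fun i _ => ψ i)
  | clifford {n : ℕ} (U : Matrix (Reg p n) (Reg p n) ℂ) (h : IsClifford U) : IsStab U
  | sqrt : IsStab (n := 0) (m := 0) (((Real.sqrt p : ℝ) : ℂ) • 1)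
  | invSqrt : IsStab (n := 0) (m := 0) ((((Real.sqrt p)⁻¹ : ℝ) : ℂ) • 1)
  | cup (n : ℕ) : IsStab (cup p n)
  | comp {n m k : ℕ} (B : Matrix (Reg p k) (Reg p m) ℂ) (A : Matrix (Reg p m) (Reg p n) ℂ)
      (hB : IsStab B) (hA : IsStab A) : IsStab (B * A)
  | tensor {n m n' m' : ℕ} (A : Matrix (Reg p m) (Reg p n) ℂ)
      (B : Matrix (Reg p m') (Reg p n') ℂ) (hA : IsStab A) (hB : IsStab B) :
      IsStab (tensor A B)
  | dagger {n m : ℕ} (A : Matrix (Reg p m) (Reg p n) ℂ) (hA : IsStab A) : IsStab Aᴴ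

theorem isStab_one (n : ℕ) : IsStab (1 : Matrix (Reg p n) (Reg p n) ℂ) :=
  IsStab.clifford 1 ⟨one_mem _, fun P hP => by simpa using hP⟩

/-- The (identity) coherence map between equal numbers of qupits, on basis labels. -/
def castReg {n n' : ℕ} (h : n = n') : Reg p n → Reg p n' := fun u i => u (Fin.cast h.symm i)

theorem IsStab.castSource {n n' m : ℕ} (h : n = n') {A : Matrix (Reg p m) (Reg p n') ℂ}
    (hA : IsStab A) : IsStab (A.submatrix id (castReg (p := p) h)) := by
  subst h
  exact hA

/-! ## The category `CPM(Stab_p)` -/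

/-- A pair `(f, S)` with `f : n ⊗ S ⟶ m` in `Stab_p`. -/
structure Pair (p n m : ℕ) [Fact p.Prime] where
  env : ℕ
  map : Matrix (Reg p m) (Reg p (n + env)) ℂ
  isStab : IsStab map

/-- The doubled map `n ⊗ n* ⟶ m ⊗ m*` of a pair `(f, S)`: a copy of `f` and a copy of its complex
conjugate, joined along `S`. -/
def Pair.double {n m : ℕ} (f : Pair p n m) :
    Matrix (Reg p m × Reg p m) (Reg p n × Reg p n) ℂ :=
  Matrix.of fun y x => ∑ s : Reg p f.env,
    f.map y.1 (Fin.append x.1 s) * star (f.map y.2 (Fin.append x.2 s))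

/-- Two pairs are equivalent when their doubled maps agree. -/
instance Pair.setoid (p n m : ℕ) [Fact p.Prime] : Setoid (Pair p n m) where
  r f g := f.double = g.double
  iseqv := ⟨fun _ => rfl, Eq.symm, Eq.trans⟩

/-- The pure map `f : n ⟶ m` of `Stab_p` as a pair `(f, I)`. -/
def Pair.pure {n m : ℕ} (A : Matrix (Reg p m) (Reg p n) ℂ) (hA : IsStab A) : Pair p n m where
  env := 0
  map := A
  isStab := hA

/-- Composition `(g, T) ∘ (f, S) = (g ∘ (f ⊗ 1_T), S ⊗ T)`. -/
def Pair.comp {n m k : ℕ} (f : Pair p n m) (g : Pair p m k) : Pair p n k where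
  env := f.env + g.env
  map := (g.map * tensor f.map (1 : Matrix (Reg p g.env) (Reg p g.env) ℂ)).submatrix id
    (castReg (Nat.add_assoc n f.env g.env).symm)
  isStab := ((g.isStab.comp _ _ (f.isStab.tensor _ _ (isStab_one _)))).castSource _

/-- The scalar multiple of the morphism `(f, T)` by the scalar `(l, S) : I ⟶ I`, i.e. the tensor
product of the two. -/
def Pair.smul {n m : ℕ} (l : Pair p 0 0) (f : Pair p n m) : Pair p n m where
  env := f.env + l.env
  map := (tensor f.map l.map).submatrix id
    (castReg (by omega : n + (f.env + l.env) = (n + f.env) + (0 + l.env)))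
  isStab := (f.isStab.tensor _ _ l.isStab).castSource _

/-- The trace `n ⟶ I`: the cap `n ⊗ n* ⟶ I`, with environment `n*`. -/
def Pair.trace (p n : ℕ) [Fact p.Prime] : Pair p n 0 where
  env := n
  map := (cup p n)ᴴ
  isStab := (IsStab.cup n).dagger

theorem sum_append {a b : ℕ} (F : Reg p (a + b) → ℂ) :
    ∑ w, F w = ∑ s : Reg p a, ∑ t : Reg p b, F (Fin.append s t) := by
  rw [← (Fin.appendEquiv a b).sum_comp, Fintype.sum_prod_type]
  rfl

theorem tensor_append {n m n' m' : ℕ} (A : Matrix (Reg p m) (Reg p n) ℂ)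
    (B : Matrix (Reg p m') (Reg p n') ℂ) (y : Reg p m) (y' : Reg p m') (x : Reg p n)
    (x' : Reg p n') :
    StabTheory.tensor A B (Fin.append y y') (Fin.append x x') = A y x * B y' x' := by
  simp [StabTheory.tensor]

theorem Pair.double_apply {n m : ℕ} (f : Pair p n m) (y : Reg p m × Reg p m)
    (x : Reg p n × Reg p n) :
    f.double y x = ∑ s : Reg p f.env,
      f.map y.1 (Fin.append x.1 s) * star (f.map y.2 (Fin.append x.2 s)) := rfl

theorem Pair.comp_map_apply {n m k : ℕ} (f : Pair p n m) (g : Pair p m k) (z : Reg p k)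
    (x : Reg p n) (s : Reg p f.env) (t : Reg p g.env) :
    (f.comp g).map z (Fin.append x (Fin.append s t)) =
      ∑ y, g.map z (Fin.append y t) * f.map y (Fin.append x s) := by
  have hc : castReg (p := p) (Nat.add_assoc n f.env g.env).symm
      (Fin.append x (Fin.append s t)) = Fin.append (Fin.append x s) t := by
    rw [Fin.append_assoc]
    funext i
    simp [castReg]
  simp only [Pair.comp, Matrix.submatrix_apply, id, hc, Matrix.mul_apply]
  rw [sum_append]
  refine Finset.sum_congr rfl fun y _ => ?_
  rw [Finset.sum_eq_single t]
  · rw [tensor_append, Matrix.one_apply_eq, mul_one]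
  · intro t' _ ht
    rw [tensor_append, Matrix.one_apply_ne ht, mul_zero, mul_zero]
  · simp

theorem Pair.double_comp {n m k : ℕ} (f : Pair p n m) (g : Pair p m k) :
    (f.comp g).double = g.double * f.double := by
  ext z x
  rw [Matrix.mul_apply, Fintype.sum_prod_type, Pair.double_apply]
  refine (sum_append (a := f.env) (b := g.env) _).trans ?_
  simp only [Pair.comp_map_apply, star_sum, star_mul', Finset.sum_mul_sum, Pair.double_apply]
  calc _ = ∑ s : Reg p f.env, ∑ y : Reg p m, ∑ y' : Reg p m, ∑ t : Reg p g.env,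
        g.map z.1 (Fin.append y t) * f.map y (Fin.append x.1 s) *
          (star (g.map z.2 (Fin.append y' t)) * star (f.map y' (Fin.append x.2 s))) := by
        refine Finset.sum_congr rfl fun s _ => ?_
        rw [Finset.sum_comm]
        refine Finset.sum_congr rfl fun y _ => Finset.sum_comm
    _ = ∑ y : Reg p m, ∑ y' : Reg p m, ∑ s : Reg p f.env, ∑ t : Reg p g.env,
        g.map z.1 (Fin.append y t) * f.map y (Fin.append x.1 s) *
          (star (g.map z.2 (Fin.append y' t)) * star (f.map y' (Fin.append x.2 s))) := by
        rw [Finset.sum_comm]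
        refine Finset.sum_congr rfl fun y _ => Finset.sum_comm
    _ = _ := by
        refine Finset.sum_congr rfl fun y _ => Finset.sum_congr rfl fun y' _ => ?_
        rw [Finset.sum_comm]
        refine Finset.sum_congr rfl fun t _ => Finset.sum_congr rfl fun s _ => ?_
        ring

theorem Pair.smul_map_apply {n m : ℕ} (l : Pair p 0 0) (f : Pair p n m) (y : Reg p m)
    (x : Reg p n) (t : Reg p f.env) (s : Reg p l.env) :
    (Pair.smul l f).map y (Fin.append x (Fin.append t s)) =
      f.map y (Fin.append x t) * l.map 0 (Fin.append 0 s) := by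
  have hc : castReg (p := p) (by omega : n + (f.env + l.env) = (n + f.env) + (0 + l.env))
      (Fin.append x (Fin.append t s)) =
        Fin.append (Fin.append x t) (Fin.append (0 : Reg p 0) s) := by
    funext i
    rcases i with ⟨i, hi⟩
    simp only [castReg, Fin.append, Fin.addCases, Fin.cast_mk, eq_rec_constant,
      Nat.not_lt_zero, dite_false, Fin.subNat_mk, Fin.castLT_mk]
    split_ifs <;> first | rfl | (exfalso; omega) | (congr 1; ext; simp; omega)
  have hy : y = (Fin.append y (0 : Reg p 0) : Reg p (m + 0)) := by
    rw [Fin.append_right_nil _ _ rfl]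
    rfl
  simp only [Pair.smul, Matrix.submatrix_apply, id, hc]
  conv_lhs => rw [hy]
  exact tensor_append _ _ _ _ _ _

theorem Pair.double_smul {n m : ℕ} (l : Pair p 0 0) (f : Pair p n m) :
    (Pair.smul l f).double = l.double 0 0 • f.double := by
  ext y x
  rw [Matrix.smul_apply, Pair.double_apply]
  refine (sum_append (a := f.env) (b := l.env) _).trans ?_
  simp only [Pair.smul_map_apply, Pair.double_apply, star_mul', smul_eq_mul, Finset.sum_mul_sum,
    Prod.fst_zero, Prod.snd_zero]
  rw [Finset.sum_comm]
  refine Finset.sum_congr rfl fun t _ => Finset.sum_congr rfl fun s _ => ?_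
  ring

theorem Pair.double_one (n : ℕ) :
    (Pair.pure (1 : Matrix (Reg p n) (Reg p n) ℂ) (isStab_one n)).double = 1 := by
  ext y x
  have h (u : Reg p n) (s : Reg p 0) : (Fin.append u s : Reg p (n + 0)) = u := by
    rw [Fin.append_right_nil _ _ rfl]
    rfl
  rw [Pair.double_apply]
  refine (Fintype.sum_unique (ι := Reg p 0) _).trans ?_
  simp only [Pair.pure]
  erw [h, h]
  rcases y with ⟨y, y'⟩
  rcases x with ⟨x, x'⟩
  by_cases h1 : y = x <;> by_cases h2 : y' = x' <;> simp [Matrix.one_apply, h1, h2]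

/-- The objects of `CPM(Stab_p)`: systems of `n` qupits. -/
structure CPMStab (p : ℕ) where
  qupits : ℕ

namespace CPMStab

/-- Morphisms of `CPM(Stab_p)` are equivalence classes of pairs `(f, S)`. -/
instance : Category (CPMStab p) where
  Hom X Y := Quotient (Pair.setoid p X.qupits Y.qupits)
  id X := Quotient.mk _ (Pair.pure 1 (isStab_one X.qupits))
  comp {X Y Z} := Quotient.map₂ (sa := Pair.setoid p X.qupits Y.qupits)
    (sb := Pair.setoid p Y.qupits Z.qupits) (sc := Pair.setoid p X.qupits Z.qupits) Pair.comp
    fun f f' hf g g' hg => by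
      change (f.comp g).double = (f'.comp g').double
      rw [Pair.double_comp, Pair.double_comp, show f.double = f'.double from hf,
        show g.double = g'.double from hg]
  id_comp {X Y} f := by
    induction f using Quotient.inductionOn with
    | h f =>
      refine Quotient.sound (s := Pair.setoid p X.qupits Y.qupits) ?_
      change Pair.double _ = Pair.double _
      rw [Pair.double_comp, Pair.double_one, Matrix.mul_one]
  comp_id {X Y} f := by
    induction f using Quotient.inductionOn with
    | h f =>
      refine Quotient.sound (s := Pair.setoid p X.qupits Y.qupits) ?_
      change Pair.double _ = Pair.double _
      rw [Pair.double_comp, Pair.double_one, Matrix.one_mul]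
  assoc {W X Y Z} f g h := by
    induction f using Quotient.inductionOn with
    | h f =>
    induction g using Quotient.inductionOn with
    | h g =>
    induction h using Quotient.inductionOn with
    | h h =>
      refine Quotient.sound (s := Pair.setoid p W.qupits Z.qupits) ?_
      change Pair.double _ = Pair.double _
      rw [Pair.double_comp, Pair.double_comp, Pair.double_comp, Pair.double_comp,
        Matrix.mul_assoc]

/-- The monoidal unit of `CPM(Stab_p)`. -/
abbrev unit (p : ℕ) : CPMStab p := ⟨0⟩

variable {X Y Z : CPMStab p}

/-- The doubled map of a morphism: the matrix of the completely positive map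
`ρ ↦ f (ρ ⊗ 1_S) f†` that it represents. -/
def double (f : X ⟶ Y) :
    Matrix (Reg p Y.qupits × Reg p Y.qupits) (Reg p X.qupits × Reg p X.qupits) ℂ :=
  Quotient.lift (s := Pair.setoid p X.qupits Y.qupits) Pair.double (fun _ _ h => h) f

theorem double_injective {f g : X ⟶ Y} (h : double f = double g) : f = g := by
  induction f using Quotient.inductionOn with
  | h f =>
  induction g using Quotient.inductionOn with
  | h g => exact Quotient.sound (s := Pair.setoid p X.qupits Y.qupits) h

theorem double_id (X : CPMStab p) : double (𝟙 X) = 1 := Pair.double_one _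

theorem double_comp (f : X ⟶ Y) (g : Y ⟶ Z) : double (f ≫ g) = double g * double f := by
  induction f using Quotient.inductionOn with
  | h f =>
  induction g using Quotient.inductionOn with
  | h g => exact Pair.double_comp f g

/-- The multiple `λ • f` of a morphism by a scalar `λ : I ⟶ I`, i.e. their tensor product. -/
def scale (l : unit p ⟶ unit p) (f : X ⟶ Y) : X ⟶ Y :=
  Quotient.map₂ (sa := Pair.setoid p 0 0) (sb := Pair.setoid p X.qupits Y.qupits)
    (sc := Pair.setoid p X.qupits Y.qupits) Pair.smul
    (fun l l' hl f f' hf => by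
      change (Pair.smul l f).double = (Pair.smul l' f').double
      rw [Pair.double_smul, Pair.double_smul, show l.double = l'.double from hl,
        show f.double = f'.double from hf]) l f

theorem double_scale (l : unit p ⟶ unit p) (f : X ⟶ Y) :
    double (scale l f) = double l 0 0 • double f := by
  induction f using Quotient.inductionOn with
  | h f =>
  induction l using Quotient.inductionOn with
  | h l => exact Pair.double_smul l f

theorem double_scalar_comp (l m : unit p ⟶ unit p) :
    double (l ≫ m) 0 0 = double l 0 0 * double m 0 0 := by
  rw [double_comp, Matrix.mul_apply]
  refine (Fintype.sum_subsingleton (ι := Reg p 0 × Reg p 0) _ 0).trans ?_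
  rw [mul_comm]

theorem double_scalar_id : double (𝟙 (unit p)) 0 0 = 1 := by
  rw [double_id, Matrix.one_apply_eq]

theorem double_scalar_ne_zero (l : unit p ⟶ unit p) [IsIso l] : double l 0 0 ≠ 0 := by
  intro h
  have := double_scalar_comp l (inv l)
  rw [IsIso.hom_inv_id, double_scalar_id, h, zero_mul] at this
  exact one_ne_zero this

/-! ## Causal maps -/

/-- The trace `Tr_X : X ⟶ I`. -/
def trace (X : CPMStab p) : X ⟶ unit p := Quotient.mk _ (Pair.trace p X.qupits)

/-- A morphism is causal when it preserves the trace. -/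
def causal (p : ℕ) [Fact p.Prime] : MorphismProperty (CPMStab p) :=
  fun X Y f => f ≫ trace Y = trace X

instance : (causal p).IsMultiplicative where
  id_mem X := Category.id_comp _
  comp_mem f g hf hg := by
    change (f ≫ g) ≫ _ = _
    rw [Category.assoc, show g ≫ _ = _ from hg, show f ≫ _ = _ from hf]

end CPMStab

/-- The category `Caus(CPM(Stab_p))`. -/
abbrev CausCPMStab (p : ℕ) [Fact p.Prime] : Type := WideSubcategory (CPMStab.causal p)

/-! ## The category `Proj(CPM(Stab_p))` -/

/-- Objects of `Proj(CPM(Stab_p))`. -/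
structure ProjCPMStab (p : ℕ) where
  base : CPMStab p

namespace ProjCPMStab

open CPMStab

/-- Two morphisms are identified when they differ by an invertible scalar. -/
instance projSetoid (X Y : CPMStab p) : Setoid (X ⟶ Y) where
  r f g := ∃ l : unit p ⟶ unit p, IsIso l ∧ g = scale l f
  iseqv := {
    refl f := ⟨𝟙 _, inferInstance, double_injective (by
      rw [double_scale, double_scalar_id, one_smul])⟩
    symm {f g} := by
      rintro ⟨l, hl, rfl⟩
      refine ⟨inv l, inferInstance, double_injective ?_⟩
      rw [double_scale, double_scale, smul_smul, ← double_scalar_comp, IsIso.inv_hom_id,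
        double_scalar_id, one_smul]
    trans {f g h} := by
      rintro ⟨l, hl, rfl⟩ ⟨m, hm, rfl⟩
      refine ⟨m ≫ l, inferInstance, double_injective ?_⟩
      rw [double_scale, double_scale, double_scale, smul_smul, ← double_scalar_comp] }

instance : Category (ProjCPMStab p) where
  Hom X Y := Quotient (projSetoid X.base Y.base)
  id X := Quotient.mk _ (𝟙 X.base)
  comp {X Y Z} := Quotient.map₂ (sa := projSetoid X.base Y.base) (sb := projSetoid Y.base Z.base)
    (sc := projSetoid X.base Z.base) (fun f g => f ≫ g) (by
      rintro f _ ⟨l, hl, rfl⟩ g _ ⟨m, hm, rfl⟩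
      refine ⟨l ≫ m, inferInstance, double_injective ?_⟩
      simp only [double_comp, double_scale, double_scalar_comp, Matrix.smul_mul, Matrix.mul_smul,
        smul_smul])
  id_comp f := by
    induction f using Quotient.inductionOn with
    | h f => exact congrArg (Quotient.mk _) (Category.id_comp f)
  comp_id f := by
    induction f using Quotient.inductionOn with
    | h f => exact congrArg (Quotient.mk _) (Category.comp_id f)
  assoc f g h := by
    induction f using Quotient.inductionOn with
    | h f =>
    induction g using Quotient.inductionOn with
    | h g =>
    induction h using Quotient.inductionOn with
    | h h => exact congrArg (Quotient.mk _) (Category.assoc f g h)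

end ProjCPMStab

/-! ## Stabiliser codes and affine coisotropic relations -/

/-- The symplectic complement of a set of vectors. -/
def sympComplement {n : ℕ} (L : Set (Phase p n)) : Set (Phase p n) :=
  {v | ∀ s ∈ L, symp v s = 0}

/-- The linear component of an affine subspace. -/
def linearComponent {n : ℕ} (C : Set (Phase p n)) : Set (Phase p n) :=
  {d | ∃ x ∈ C, ∃ y ∈ C, d = x - y}

/-- The labels of the group `G_C = {π(ω(a, b), b) | b ∈ L^ω}` of an affine coisotropic subspace
`C = L + a`, where `G_∅` consists of all the scalars `ξ(t)`. -/
def codeGroup {n : ℕ} (C : Set (Phase p n)) : Set (ZMod p × Phase p n) :=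
  {g | (∃ a ∈ C, g.2 ∈ sympComplement (linearComponent C) ∧ g.1 = symp a g.2) ∨
    (C = ∅ ∧ g.2 = 0)}

open Classical in
/-- The projector `Π_{G_C} = |G_C|⁻¹ ∑_{P ∈ G_C} P` onto the code space of `G_C`. -/
def codeProjector {n : ℕ} (C : Set (Phase p n)) : Matrix (Reg p n) (Reg p n) ℂ :=
  ((codeGroup C).ncard : ℂ)⁻¹ • ∑ g : ZMod p × Phase p n with g ∈ codeGroup C, pauli g.1 g.2

/-- The affine subspace `C` of an operator `ρ` proportional to a projector `Π_{G_C}`, read off from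
the Pauli operators that stabilise `ρ`: these are the `π(ω(v, b), b)` with `b ∈ L^ω`, for each
`v ∈ C = L + a`. The operator `0` is stabilised by all Pauli operators and has `C = ∅`. -/
def stabilisedSpace {n : ℕ} (ρ : Matrix (Reg p n) (Reg p n) ℂ) : Set (Phase p n) :=
  {v | ∀ (t : ZMod p) (b : Phase p n), pauli t b * ρ = ρ → t = symp v b}

/-- The identification of `(𝔽_p^{2n}, ω_n)` with its dual `(𝔽_p^{2n}, -ω_n)`, which corresponds to
complex conjugation of Pauli operators. -/
def Phase.conj {n : ℕ} (v : Phase p n) : Phase p n := (v.1, -v.2)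

/-- The direct sum `𝔽_p^{2n} ⊕ 𝔽_p^{2m} ≅ 𝔽_p^{2(n+m)}`. -/
def Phase.append {n m : ℕ} (v : Phase p n) (w : Phase p m) : Phase p (n + m) :=
  (Fin.append v.1 w.1, Fin.append v.2 w.2)

/-- The name `⌊R⌋ : I → V ⊕ W` of a relation `R : V → W`. -/
def nameOf {n m : ℕ} (R : Set (Phase p n × Phase p m)) : Set (Phase p (n + m)) :=
  (fun q => Phase.append q.1.conj q.2) '' R

/-- Affine coisotropic relations from `(𝔽_p^{2n}, ω_n)` to `(𝔽_p^{2m}, ω_m)`: affine subspaces of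
`(𝔽_p^{2n} ⊕ 𝔽_p^{2m}, -ω_n ⊕ ω_m)`, possibly empty, whose linear component contains its symplectic
complement. -/
def IsAffineCoisotropic {n m : ℕ} (R : Set (Phase p n × Phase p m)) : Prop :=
  ∃ A : AffineSubspace (ZMod p) (Phase p n × Phase p m), (A : Set (Phase p n × Phase p m)) = R ∧
    (R.Nonempty → ∀ v, (∀ s ∈ A.direction, -symp v.1 s.1 + symp v.2 s.2 = 0) → v ∈ A.direction)

namespace CPMStab

variable {X Y : CPMStab p}

/-- The Choi matrix of a morphism, i.e. the operator `∑_{x,x'} |x⟩⟨x'| ⊗ f(|x⟩⟨x'|)` that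
represents its name `I ⟶ X* ⊗ Y`. -/
def choi (f : X ⟶ Y) :
    Matrix (Reg p (X.qupits + Y.qupits)) (Reg p (X.qupits + Y.qupits)) ℂ :=
  Matrix.of fun u u' => double f
    (u ∘ Fin.natAdd X.qupits, u' ∘ Fin.natAdd X.qupits)
    (u ∘ Fin.castAdd Y.qupits, u' ∘ Fin.castAdd Y.qupits)

/-- The relation `rel(f)` between phase spaces that is represented by a mixed stabiliser map. -/
def rel (f : X ⟶ Y) : Set (Phase p X.qupits × Phase p Y.qupits) :=
  {q | Phase.append q.1.conj q.2 ∈ stabilisedSpace (choi f)}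

/-- The code projector of a morphism: the projector of the stabiliser code of the name of its
relation. -/
def projector (f : X ⟶ Y) :
    Matrix (Reg p (X.qupits + Y.qupits)) (Reg p (X.qupits + Y.qupits)) ℂ :=
  codeProjector (nameOf (rel f))

/-- The Löwner order (`A ≤ B` iff `B - A` is positive semidefinite) on code projectors. -/
def loewnerLE ⦃X Y : CPMStab p⦄ (f g : X ⟶ Y) : Prop := projector f ≤ projector g

theorem rel_scale (l : unit p ⟶ unit p) [IsIso l] (f : X ⟶ Y) : rel (scale l f) = rel f := by
  have h : choi (scale l f) = double l 0 0 • choi f := by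
    ext u u'
    simp [choi, double_scale]
  have hl := double_scalar_ne_zero l
  ext q
  simp only [rel, stabilisedSpace, h, Set.mem_ofPred_eq, Matrix.mul_smul]
  refine forall_congr' fun t => forall_congr' fun b => ?_
  rw [smul_right_inj hl]

end CPMStab

namespace CausCPMStab

/-- The Löwner order on causal morphisms. -/
def loewnerLE ⦃X Y : CausCPMStab p⦄ (f g : X ⟶ Y) : Prop :=
  CPMStab.projector f.hom ≤ CPMStab.projector g.hom

end CausCPMStab

namespace ProjCPMStab

variable {X Y : ProjCPMStab p}

/-- The relation of a projective class of morphisms. -/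
def rel (f : X ⟶ Y) : Set (Phase p X.base.qupits × Phase p Y.base.qupits) :=
  Quotient.lift (s := projSetoid X.base Y.base) CPMStab.rel
    (by rintro f _ ⟨l, hl, rfl⟩; exact (CPMStab.rel_scale l f).symm) f

/-- The code projector of a projective class of morphisms. -/
def projector (f : X ⟶ Y) : Matrix (Reg p (X.base.qupits + Y.base.qupits))
    (Reg p (X.base.qupits + Y.base.qupits)) ℂ :=
  Quotient.lift (s := projSetoid X.base Y.base) CPMStab.projector
    (by
      rintro f _ ⟨l, hl, rfl⟩
      change codeProjector _ = codeProjector _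
      rw [CPMStab.rel_scale l f]) f

/-- The Löwner order on projective classes of morphisms. -/
def loewnerLE ⦃X Y : ProjCPMStab p⦄ (f g : X ⟶ Y) : Prop := projector f ≤ projector g

end ProjCPMStab

/-! ## Enrichment -/

/-- A relation `le` on the hom-sets makes the category `C` enriched in preordered sets: it is a
preorder on every hom-set and composition is monotone in both arguments jointly. -/
structure IsPreorderEnrichment (C : Type*) [Category C]
    (le : ∀ ⦃X Y : C⦄, (X ⟶ Y) → (X ⟶ Y) → Prop) : Prop where
  refl {X Y : C} (f : X ⟶ Y) : le f f
  trans {X Y : C} (f g h : X ⟶ Y) : le f g → le g h → le f h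
  comp {X Y Z : C} (f f' : X ⟶ Y) (g g' : Y ⟶ Z) : le f f' → le g g' → le (f ≫ g) (f' ≫ g')

/-- A relation `le` on the hom-sets makes the category `C` enriched in partially ordered sets. -/
structure IsPartialOrderEnrichment (C : Type*) [Category C]
    (le : ∀ ⦃X Y : C⦄, (X ⟶ Y) → (X ⟶ Y) → Prop) : Prop extends IsPreorderEnrichment C le where
  antisymm {X Y : C} (f g : X ⟶ Y) : le f g → le g f → f = g

end StabTheory

end

open StabTheory

noncomputable section

namespace StabTheory

variable {p n m : ℕ}

/-! ## Symplectic form and character sums -/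

/-! For odd p the phase point operators A_v, Fourier sums of Pauli operators, form a basis of the
operators that is orthogonal for the trace form; the coordinates of an operator in it are its
discrete Wigner function. In this basis the map ρ ↦ AρA† of a stabiliser map A is a matrix whose
entries are 0 or one fixed power of p, the nonzero ones filling a coset (`isFlat_transfer`). For
stabiliser states and Clifford operators the entries are character sums over a group. Flatness
survives pullback, product and summation over a subspace (`IsFlat.sum`), hence also composition,
tensor products and discarding an environment (`Pair.isFlat_cpTransfer`).

The Wigner function of the Choi matrix J is this transfer function read along names (`wigner_choi`),
so it is p^k times the indicator of a coset C = L + a. Expanding in Pauli operators makes J a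
multiple of the sum of π(ω(a,b), b) over b in L^ω. Positivity, in the form J = FF†, supplies the
rest (`isCode_of_wigner`): a unitary U with tr(UJ) = tr J fixes J, so these Pauli operators
stabilise J; any two that fix J ≠ 0 commute, so L^ω is isotropic. Hence J is a power of p times the
code projector of C, and rel(f) is the support of the transfer function (`mem_rel_iff`).

Smaller code spaces have larger stabiliser groups, so the Löwner order on projectors is inclusion of
cosets (`IsCode.projector_le_iff`). The nonzero values of a transfer function are positive, so the
sum over intermediate phase points cannot cancel: rel turns composition of maps into composition of
relations (`mem_rel_comp_iff`), which is monotone. For antisymmetry, the projector determines J up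
to a power of p; that power is an invertible scalar in Proj and is fixed by the trace of J in Caus.
-/

theorem symp_add_left (u v w : Phase p n) : symp (u + v) w = symp u w + symp v w := by
  simp only [symp, Prod.fst_add, Prod.snd_add, add_dotProduct]; ring

theorem symp_add_right (u v w : Phase p n) : symp u (v + w) = symp u v + symp u w := by
  simp only [symp, Prod.fst_add, Prod.snd_add, dotProduct_add]; ring

theorem symp_zero_left (v : Phase p n) : symp 0 v = 0 := by simp [symp]

theorem symp_zero_right (v : Phase p n) : symp v 0 = 0 := by simp [symp]

theorem symp_neg_left (u v : Phase p n) : symp (-u) v = -symp u v := by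
  simp only [symp, Prod.fst_neg, Prod.snd_neg, neg_dotProduct]; ring

theorem symp_neg_right (u v : Phase p n) : symp u (-v) = -symp u v := by
  simp only [symp, Prod.fst_neg, Prod.snd_neg, dotProduct_neg]; ring

theorem symp_sub_left (u v w : Phase p n) : symp (u - v) w = symp u w - symp v w := by
  rw [sub_eq_add_neg, symp_add_left, symp_neg_left, sub_eq_add_neg]

theorem symp_smul_right (k : ZMod p) (u v : Phase p n) : symp u (k • v) = k * symp u v := by
  simp only [symp, Prod.smul_fst, Prod.smul_snd, dotProduct_smul, smul_eq_mul]; ring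

theorem symp_smul_left (k : ZMod p) (u v : Phase p n) : symp (k • u) v = k * symp u v := by
  simp only [symp, Prod.smul_fst, Prod.smul_snd, smul_dotProduct, smul_eq_mul]; ring

theorem symp_comm (u v : Phase p n) : symp u v = -symp v u := by
  simp only [symp, dotProduct_comm]; ring

theorem symp_self (v : Phase p n) : symp v v = 0 := by simp [symp, dotProduct_comm]

variable [Fact p.Prime]

theorem two_ne_zero_of_odd (hp : p ≠ 2) : (2 : ZMod p) ≠ 0 := by
  intro h
  have h2 : ((2 : ℕ) : ZMod p) = 0 := by exact_mod_cast h
  rw [ZMod.natCast_eq_zero_iff] at h2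
  exact hp ((Nat.prime_dvd_prime_iff_eq Fact.out Nat.prime_two).1 h2)

theorem natCast_prime_ne_zero : (p : ℂ) ≠ 0 := by
  exact_mod_cast (Fact.out : p.Prime).ne_zero

theorem stdAddChar_ne_zero (a : ZMod p) : ZMod.stdAddChar a ≠ (0 : ℂ) := by
  intro h
  have := ZMod.stdAddChar.map_add_eq_mul a (-a)
  rw [h, zero_mul, add_neg_cancel, AddChar.map_zero_eq_one] at this
  exact one_ne_zero this

/-- Orthogonality of characters. The standard character is injective, so its pullback along φ is
trivial only for φ = 0. -/
theorem sum_stdAddChar {M : Type*} [AddCommGroup M] [Fintype M] (φ : M →+ ZMod p)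
    [Decidable (∀ b, φ b = 0)] :
    ∑ b, (ZMod.stdAddChar (φ b) : ℂ) = if ∀ b, φ b = 0 then (Fintype.card M : ℂ) else 0 := by
  classical
  have h := AddChar.sum_eq_ite ((ZMod.stdAddChar (N := p)).compAddMonoidHom φ)
  have e : (ZMod.stdAddChar (N := p)).compAddMonoidHom φ = 0 ↔ ∀ b, φ b = 0 := by
    rw [DFunLike.ext_iff]
    refine forall_congr' fun b => ?_
    rw [AddChar.compAddMonoidHom_apply, AddChar.zero_apply,
      ← AddChar.map_zero_eq_one (ZMod.stdAddChar (N := p)), ZMod.injective_stdAddChar.eq_iff]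
  simp only [e, AddChar.compAddMonoidHom_apply] at h
  rw [h]

theorem sum_stdAddChar_dotProduct (z : Reg p n) :
    ∑ i : Reg p n, (ZMod.stdAddChar (z ⬝ᵥ i) : ℂ) = if z = 0 then (p : ℂ) ^ n else 0 := by
  classical
  have h := sum_stdAddChar (AddMonoidHom.mk' (fun i : Reg p n => z ⬝ᵥ i) (dotProduct_add z))
  have e : (∀ i, z ⬝ᵥ i = 0) ↔ z = 0 := by
    constructor
    · intro h
      exact dotProduct_eq _ _ fun i => by rw [h, zero_dotProduct]
    · rintro rfl i; exact zero_dotProduct i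
  simpa [e, ZMod.card] using h

theorem sum_stdAddChar_symp (v : Phase p n) :
    ∑ b : Phase p n, (ZMod.stdAddChar (symp v b) : ℂ) =
      if v = 0 then (p : ℂ) ^ n * (p : ℂ) ^ n else 0 := by
  rw [Fintype.sum_prod_type]
  have h (x z : Reg p n) : (ZMod.stdAddChar (symp v (x, z)) : ℂ) =
      ZMod.stdAddChar ((-v.2) ⬝ᵥ x) * ZMod.stdAddChar (v.1 ⬝ᵥ z) := by
    rw [← AddChar.map_add_eq_mul]; congr 1; simp only [symp, neg_dotProduct]; ring
  simp only [h, ← Finset.mul_sum, ← Finset.sum_mul, sum_stdAddChar_dotProduct, neg_eq_zero]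
  by_cases h1 : v.1 = 0 <;> by_cases h2 : v.2 = 0 <;> simp [h1, h2, Prod.ext_iff]

/-! ## Algebra of Pauli operators -/

theorem pauli_eq_smul (a : ZMod p) (v : Phase p n) :
    pauli a v = (ZMod.stdAddChar a : ℂ) • pauli 0 v := by
  ext i j
  simp only [pauli, Matrix.of_apply, Matrix.smul_apply, smul_eq_mul, mul_ite, mul_zero]
  rw [← AddChar.map_add_eq_mul]
  congr 2; ring

theorem pauli_zero (a : ZMod p) : pauli a (0 : Phase p n) = (ZMod.stdAddChar a : ℂ) • 1 := by
  ext i j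
  simp [pauli, Matrix.one_apply]

/-- The half in the phase of `pauli`, available since p is odd, makes the cocycle alternating:
phases simply add on isotropic subspaces. -/
theorem pauli_mul (hp : p ≠ 2) (a b : ZMod p) (v w : Phase p n) :
    pauli a v * pauli b w = pauli (a + b - 2⁻¹ * symp v w) (v + w) := by
  have h2 := two_ne_zero_of_odd hp
  ext i j
  rw [Matrix.mul_apply, Finset.sum_eq_single (j + w.1)]
  · simp only [pauli, Matrix.of_apply, if_true, Prod.fst_add, Prod.snd_add]
    rw [add_assoc, add_comm w.1 v.1]
    split_ifs
    · rw [← AddChar.map_add_eq_mul]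
      congr 1
      simp only [symp, dotProduct_add, add_dotProduct, dotProduct_comm v.1 w.2]
      field_simp
      ring
    · rw [zero_mul]
  · intro k _ hk
    simp only [pauli, Matrix.of_apply]
    rw [if_neg hk, mul_zero]
  · simp

theorem pauli_conjTranspose (hp : p ≠ 2) (a : ZMod p) (v : Phase p n) :
    (pauli a v)ᴴ = pauli (-a) (-v) := by
  have h2 := two_ne_zero_of_odd hp
  ext i j
  simp only [pauli, Matrix.conjTranspose_apply, Matrix.of_apply, Prod.fst_neg, Prod.snd_neg]
  have e : j = i + v.1 ↔ i = j + -v.1 := by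
    constructor <;> (rintro rfl; abel)
  by_cases h : j = i + v.1
  · rw [if_pos h, if_pos (e.1 h), RCLike.star_def, ← AddChar.map_neg_eq_conj]
    subst h
    congr 1
    simp only [dotProduct_add, neg_dotProduct, dotProduct_neg]
    field_simp
    ring
  · rw [if_neg h, if_neg (mt e.2 h), star_zero]

theorem trace_pauli (a : ZMod p) (v : Phase p n) :
    (pauli a v).trace = if v = 0 then (p : ℂ) ^ n * ZMod.stdAddChar a else 0 := by
  split_ifs with h
  · subst h
    rw [pauli_zero, Matrix.trace_smul, Matrix.trace_one, smul_eq_mul, mul_comm]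
    simp [ZMod.card]
  · simp only [Matrix.trace, Matrix.diag_apply, pauli, Matrix.of_apply]
    by_cases h1 : v.1 = 0
    · have h2 : v.2 ≠ 0 := fun h2 => h (Prod.ext h1 h2)
      simp only [h1, add_zero, if_true, AddChar.map_add_eq_mul, ← Finset.mul_sum,
        sum_stdAddChar_dotProduct, if_neg h2, mul_zero]
    · exact Finset.sum_eq_zero fun i _ => if_neg fun hi => h1 (by simpa using hi)

/-- Multiply by the inverse of the second operator and take traces: a Pauli operator has nonzero
trace only over the zero vector. -/
theorem pauli_injective (hp : p ≠ 2) {a b : ZMod p} {v w : Phase p n}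
    (h : pauli a v = pauli b w) : a = b ∧ v = w := by
  have h1 : (pauli a v * pauli (-b) (-w)).trace = (pauli b w * pauli (-b) (-w)).trace := by rw [h]
  have h0 : (p : ℂ) ^ n ≠ 0 := pow_ne_zero _ natCast_prime_ne_zero
  simp only [pauli_mul hp, symp_neg_right, trace_pauli, symp_self, add_neg_cancel, if_true] at h1
  split_ifs at h1 with hv
  · obtain rfl : v = w := by simpa [← sub_eq_add_neg, sub_eq_zero] using hv
    refine ⟨?_, rfl⟩
    have := ZMod.injective_stdAddChar (mul_left_cancel₀ h0 h1)
    rw [symp_self] at this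
    simpa [← sub_eq_add_neg, sub_eq_zero] using this
  · exact absurd h1.symm (mul_ne_zero h0 (stdAddChar_ne_zero _))

theorem pauli_mul_conjTranspose (hp : p ≠ 2) (a : ZMod p) (v : Phase p n) :
    pauli a v * (pauli a v)ᴴ = 1 := by
  rw [pauli_conjTranspose hp, pauli_mul hp]
  simp [symp_neg_right, symp_self, pauli_zero]

theorem pauli_mem_unitaryGroup (hp : p ≠ 2) (a : ZMod p) (v : Phase p n) :
    pauli a v ∈ Matrix.unitaryGroup (Reg p n) ℂ :=
  Matrix.mem_unitaryGroup_iff.2 (pauli_mul_conjTranspose hp a v)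

/-! ## Phase point operators and Wigner functions -/

/-- The phase point operator at `v`, whose value on the Pauli operator `π(0, b)` is
`ξ(-ω(v, b))`. -/
def phasePoint (v : Phase p n) : Matrix (Reg p n) (Reg p n) ℂ :=
  Matrix.of fun i j => if i + j = -(2 : ZMod p) • v.1 then ZMod.stdAddChar (v.2 ⬝ᵥ (j - i)) else 0

theorem phasePoint_eq_sum (hp : p ≠ 2) (v : Phase p n) :
    phasePoint v = ((p : ℂ) ^ n)⁻¹ • ∑ b : Phase p n, pauli (symp v b) b := by
  have h2 := two_ne_zero_of_odd hp
  ext i j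
  -- The entry at (i, j) selects position part i - j; the remaining sum over momenta is a character
  -- sum.
  rw [Matrix.smul_apply, Matrix.sum_apply, Fintype.sum_prod_type, Finset.sum_eq_single (i - j)]
  · have h (z : Reg p n) : pauli (symp v (i - j, z)) (i - j, z) i j =
        ZMod.stdAddChar (v.2 ⬝ᵥ (j - i)) *
          ZMod.stdAddChar ((v.1 + (2⁻¹ : ZMod p) • (i + j)) ⬝ᵥ z) := by
      simp only [pauli, Matrix.of_apply, add_sub_cancel, if_true, ← AddChar.map_add_eq_mul]
      congr 1
      simp only [symp, dotProduct_sub, sub_dotProduct, add_dotProduct, smul_dotProduct,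
        smul_eq_mul, dotProduct_comm z]
      field_simp
      ring
    simp only [h, ← Finset.mul_sum, sum_stdAddChar_dotProduct, phasePoint, Matrix.of_apply]
    have e : v.1 + (2⁻¹ : ZMod p) • (i + j) = 0 ↔ i + j = -(2 : ZMod p) • v.1 := by
      rw [← smul_right_inj h2, smul_add, smul_smul, mul_inv_cancel₀ h2, one_smul, smul_zero,
        add_comm, add_eq_zero_iff_eq_neg, neg_smul]
    simp only [e]
    split_ifs
    · rw [smul_eq_mul, mul_comm, mul_assoc, mul_inv_cancel₀ (pow_ne_zero _ natCast_prime_ne_zero),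
        mul_one]
    · simp
  · intro x _ hx
    refine Finset.sum_eq_zero fun z _ => ?_
    simp only [pauli, Matrix.of_apply]
    refine if_neg fun h => hx ?_
    rw [h]; abel
  · simp

theorem trace_phasePoint_mul_pauli (hp : p ≠ 2) (v b : Phase p n) (t : ZMod p) :
    (phasePoint v * pauli t b).trace = ZMod.stdAddChar (t - symp v b) := by
  rw [phasePoint_eq_sum hp, Matrix.smul_mul, Matrix.trace_smul, Finset.sum_mul, Matrix.trace_sum,
    Finset.sum_eq_single (-b)]
  · rw [pauli_mul hp, trace_pauli, if_pos (neg_add_cancel b), smul_eq_mul, ← mul_assoc,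
      inv_mul_cancel₀ (pow_ne_zero _ natCast_prime_ne_zero), one_mul]
    congr 1
    simp only [symp_neg_left, symp_neg_right, symp_self]; ring
  · intro c _ hc
    rw [pauli_mul hp, trace_pauli, if_neg fun h => hc (eq_neg_of_add_eq_zero_left h)]
  · simp

/-- The Wigner function of an operator. -/
def wigner (M : Matrix (Reg p n) (Reg p n) ℂ) (v : Phase p n) : ℂ :=
  ((p : ℂ) ^ n)⁻¹ * (phasePoint v * M).trace

/-- Completeness of the phase point operators, entry by entry; this is what makes the Wigner
expansion `eq_sum_wigner` an identity. -/
theorem sum_phasePoint_mul (hp : p ≠ 2) (i j k l : Reg p n) :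
    ∑ v : Phase p n, phasePoint v k l * phasePoint v i j =
      if i = l ∧ j = k then (p : ℂ) ^ n else 0 := by
  have h2 := two_ne_zero_of_odd hp
  have h (x z : Reg p n) : phasePoint (x, z) k l * phasePoint (x, z) i j =
      if k + l = -(2 : ZMod p) • x ∧ i + j = -(2 : ZMod p) • x then
        ZMod.stdAddChar ((l - k + (j - i)) ⬝ᵥ z) else 0 := by
    simp only [phasePoint, Matrix.of_apply]
    rw [add_dotProduct, dotProduct_comm _ z, dotProduct_comm _ z, AddChar.map_add_eq_mul]
    split_ifs <;> first | rfl | (exfalso; tauto) | simp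
  rw [Fintype.sum_prod_type, Finset.sum_eq_single (-(2⁻¹ : ZMod p) • (i + j))]
  · simp only [h, smul_smul, neg_mul_neg, mul_inv_cancel₀ h2, one_smul, and_true]
    split_ifs with h1 h3 h3
    · rw [sum_stdAddChar_dotProduct, if_pos]
      obtain ⟨rfl, rfl⟩ := h3; abel
    · rw [sum_stdAddChar_dotProduct, if_neg]
      intro h4
      apply h3
      -- Equal sums i + j = k + l and opposite differences determine the indices once 2 is
      -- invertible.
      have h5 : (2 : ZMod p) • (i - l) = 0 := by
        have e : (2 : ZMod p) • (i - l) = (i + j - (k + l)) - (l - k + (j - i)) := by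
          rw [two_smul]; abel
        rw [e, h4, h1]; simp
      have h6 : i = l := by simpa [h2, sub_eq_zero] using h5
      subst h6
      refine ⟨rfl, ?_⟩
      rw [add_comm k] at h1
      exact (add_left_cancel h1).symm
    · obtain ⟨rfl, rfl⟩ := h3
      exact absurd (add_comm _ _) h1
    · simp
  · intro x _ hx
    refine Finset.sum_eq_zero fun z _ => ?_
    rw [h, if_neg]
    rintro ⟨-, h1⟩
    apply hx
    rw [h1, smul_smul, neg_mul_neg, inv_mul_cancel₀ h2, one_smul]
  · simp

theorem eq_sum_wigner (hp : p ≠ 2) (M : Matrix (Reg p n) (Reg p n) ℂ) :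
    M = ∑ v, wigner M v • phasePoint v := by
  have h0 : (p : ℂ) ^ n ≠ 0 := pow_ne_zero _ natCast_prime_ne_zero
  ext i j
  simp only [Matrix.sum_apply, Matrix.smul_apply, wigner, Matrix.trace, Matrix.diag_apply,
    Matrix.mul_apply, smul_eq_mul, Finset.mul_sum, Finset.sum_mul]
  rw [Finset.sum_comm]
  calc M i j = ∑ k, ∑ l, ((p : ℂ) ^ n)⁻¹ * M l k *
        ∑ v : Phase p n, phasePoint v k l * phasePoint v i j := by
        simp only [sum_phasePoint_mul hp]
        rw [Finset.sum_eq_single j, Finset.sum_eq_single i]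
        · rw [if_pos ⟨rfl, rfl⟩]; field_simp
        · intro l _ hl
          rw [if_neg fun h => hl h.1.symm, mul_zero]
        · simp
        · intro k _ hk
          refine Finset.sum_eq_zero fun l _ => ?_
          rw [if_neg fun h => hk h.2.symm, mul_zero]
        · simp
    _ = _ := by
        refine Finset.sum_congr rfl fun k _ => ?_
        rw [Finset.sum_comm]
        refine Finset.sum_congr rfl fun l _ => ?_
        rw [Finset.mul_sum]
        exact Finset.sum_congr rfl fun v _ => by ring

theorem wigner_sum {ι : Type*} (s : Finset ι) (M : ι → Matrix (Reg p n) (Reg p n) ℂ)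
    (v : Phase p n) : wigner (∑ i ∈ s, M i) v = ∑ i ∈ s, wigner (M i) v := by
  simp only [wigner, Finset.mul_sum, Matrix.trace_sum]

theorem wigner_smul (c : ℂ) (M : Matrix (Reg p n) (Reg p n) ℂ) (v : Phase p n) :
    wigner (c • M) v = c * wigner M v := by
  simp only [wigner, Matrix.mul_smul, Matrix.trace_smul, smul_eq_mul]; ring

theorem wigner_pauli (hp : p ≠ 2) (t : ZMod p) (b v : Phase p n) :
    wigner (pauli t b) v = ((p : ℂ) ^ n)⁻¹ * ZMod.stdAddChar (t - symp v b) := by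
  rw [wigner, trace_phasePoint_mul_pauli hp]

theorem sum_phasePoint (hp : p ≠ 2) : ∑ v : Phase p n, phasePoint v = (p : ℂ) ^ n • 1 := by
  have h := eq_sum_wigner hp (pauli 0 (0 : Phase p n))
  simp only [wigner_pauli hp, symp_zero_right, sub_zero, AddChar.map_zero_eq_one, mul_one,
    ← Finset.smul_sum] at h
  rw [pauli_zero, AddChar.map_zero_eq_one, one_smul] at h
  rw [h, smul_smul, mul_inv_cancel₀ (pow_ne_zero _ natCast_prime_ne_zero), one_smul]

/-- Bending a wire transposes operators, so this is the source of the sign (x, z) ↦ (x, -z) in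
names. -/
theorem phasePoint_transpose (v : Phase p n) : (phasePoint v)ᵀ = phasePoint v.conj := by
  ext i j
  simp only [phasePoint, Matrix.transpose_apply, Matrix.of_apply, Phase.conj, add_comm j i]
  congr 2
  rw [neg_dotProduct, ← dotProduct_neg, neg_sub]

end StabTheory

end

noncomputable section

namespace StabTheory

/-! ## Flat functions: powers of `p` times indicators of affine subspaces -/

/-- A possibly empty coset of an additive subgroup. -/
def IsCoset {V : Type*} [AddCommGroup V] (C : Set V) : Prop :=
  ∀ x ∈ C, ∀ y ∈ C, ∀ z ∈ C, x - y + z ∈ C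

theorem IsCoset.preimage {V W : Type*} [AddCommGroup V] [AddCommGroup W] {C : Set V}
    (hC : IsCoset C) (φ : W →+ V) : IsCoset (φ ⁻¹' C) := fun x hx y hy z hz => by
  simpa using hC _ hx _ hy _ hz

theorem IsCoset.inter {V : Type*} [AddCommGroup V] {C D : Set V} (hC : IsCoset C)
    (hD : IsCoset D) : IsCoset (C ∩ D) := fun x hx y hy z hz =>
  ⟨hC x hx.1 y hy.1 z hz.1, hD x hx.2 y hy.2 z hz.2⟩

/-- The subgroup of which a coset is a translate. -/
def IsCoset.subgroup {V : Type*} [AddCommGroup V] {C : Set V} (hC : IsCoset C) {a : V}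
    (ha : a ∈ C) : AddSubgroup V where
  carrier := {l | a + l ∈ C}
  zero_mem' := by simpa using ha
  add_mem' {x y} hx hy := by
    have := hC _ hx _ ha _ hy
    rwa [show a + x - a + (a + y) = a + (x + y) by abel] at this
  neg_mem' {x} hx := by
    have := hC _ ha _ hx _ ha
    rwa [show a - (a + x) + a = a + -x by abel] at this

theorem IsCoset.mem_subgroup {V : Type*} [AddCommGroup V] {C : Set V} (hC : IsCoset C) {a : V}
    (ha : a ∈ C) {l : V} : l ∈ hC.subgroup ha ↔ a + l ∈ C := Iff.rfl

/-- An affine subspace with a given coset as underlying set. -/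
def IsCoset.toAffineSubspace {p : ℕ} {V : Type*} [AddCommGroup V] [Module (ZMod p) V]
    {C : Set V} (hC : IsCoset C) : AffineSubspace (ZMod p) V where
  carrier := C
  smul_vsub_vadd_mem' k x y z hx hy hz := by
    have h : x - y ∈ AddSubgroup.toZModSubmodule p (hC.subgroup hz) := by
      rw [AddSubgroup.mem_toZModSubmodule, hC.mem_subgroup, add_comm]
      exact hC _ hx _ hy _ hz
    have h2 := Submodule.smul_mem _ k h
    rw [AddSubgroup.mem_toZModSubmodule, hC.mem_subgroup, add_comm] at h2
    exact h2

/-- Scalars of the prime field act through integers, so an additive subgroup is already a subspace.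
-/
theorem card_addSubgroup_eq_pow {p : ℕ} [Fact p.Prime] {V : Type*} [AddCommGroup V]
    [Module (ZMod p) V] [Finite V] (H : AddSubgroup V) : ∃ d : ℕ, Nat.card H = p ^ d := by
  refine ⟨Module.finrank (ZMod p) (AddSubgroup.toZModSubmodule p H), ?_⟩
  have := Module.natCard_eq_pow_finrank (K := ZMod p) (V := AddSubgroup.toZModSubmodule p H)
  rwa [Nat.card_zmod] at this

open Classical in
/-- A function which is a power of `p` times the indicator function of a coset. -/
def IsFlat (p : ℕ) {V : Type*} [AddCommGroup V] (F : V → ℂ) : Prop :=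
  ∃ (k : ℤ) (C : Set V), IsCoset C ∧ ∀ v, F v = if v ∈ C then (p : ℂ) ^ k else 0

namespace IsFlat

variable {p : ℕ} {V W : Type*} [AddCommGroup V] [AddCommGroup W]

theorem comp_hom {F : V → ℂ} (hF : IsFlat p F) (φ : W →+ V) : IsFlat p fun w => F (φ w) := by
  obtain ⟨k, C, hC, h⟩ := hF
  exact ⟨k, φ ⁻¹' C, hC.preimage φ, fun w => h _⟩

theorem comp_prodMap {V' W' : Type*} [AddCommGroup V'] [AddCommGroup W'] {F : V × W → ℂ}
    (hF : IsFlat p F) (φ : V' →+ V) (ψ : W' →+ W) :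
    IsFlat p fun q : V' × W' => F (φ q.1, ψ q.2) :=
  hF.comp_hom (φ.prodMap ψ)

theorem comp_swap {F : V × W → ℂ} (hF : IsFlat p F) : IsFlat p fun q : W × V => F (q.2, q.1) :=
  hF.comp_hom ((AddMonoidHom.snd W V).prod (AddMonoidHom.fst W V))

variable [Fact p.Prime]

theorem mul {F G : V → ℂ} (hF : IsFlat p F) (hG : IsFlat p G) :
    IsFlat p fun v => F v * G v := by
  obtain ⟨k, C, hC, h⟩ := hF
  obtain ⟨l, D, hD, h'⟩ := hG
  refine ⟨k + l, C ∩ D, hC.inter hD, fun v => ?_⟩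
  beta_reduce
  rw [h, h', zpow_add₀ natCast_prime_ne_zero]
  by_cases h1 : v ∈ C <;> by_cases h2 : v ∈ D <;> simp [h1, h2]

theorem zpow_mul {F : V → ℂ} (hF : IsFlat p F) (d : ℤ) :
    IsFlat p fun v => (p : ℂ) ^ d * F v := by
  obtain ⟨k, C, hC, h⟩ := hF
  refine ⟨d + k, C, hC, fun v => ?_⟩
  beta_reduce
  rw [h, zpow_add₀ natCast_prime_ne_zero, mul_ite, mul_zero]

/-- The nonempty fibres of a projected coset are translates of one subgroup, so they all have the
same number of elements, a power of p. -/
theorem sum [Module (ZMod p) W] [Fintype W] {F : V × W → ℂ} (hF : IsFlat p F) :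
    IsFlat p fun v => ∑ w, F (v, w) := by
  classical
  obtain ⟨k, C, hC, h⟩ := hF
  obtain rfl | ⟨⟨v₀, w₀⟩, h₀⟩ := C.eq_empty_or_nonempty
  · exact ⟨k, ∅, by simp [IsCoset], fun v => by simp [h]⟩
  -- The common direction of the fibres: translations of the coset with zero first component.
  obtain ⟨d, hd⟩ := card_addSubgroup_eq_pow (p := p)
    ((hC.subgroup h₀).comap (AddMonoidHom.inr V W))
  refine ⟨k + d, {v | ∃ w, (v, w) ∈ C}, ?_, fun v => ?_⟩
  · rintro x ⟨x', hx⟩ y ⟨y', hy⟩ z ⟨z', hz⟩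
    exact ⟨_, hC _ hx _ hy _ hz⟩
  simp only [h, Set.mem_ofPred_eq]
  split_ifs with hv
  · obtain ⟨w₁, hw₁⟩ := hv
    rw [← Finset.sum_filter, Finset.sum_const, nsmul_eq_mul, mul_comm,
      zpow_add₀ natCast_prime_ne_zero, zpow_natCast]
    congr 1
    rw [← Nat.cast_pow, ← hd, Nat.card_eq_fintype_card, Fintype.card_subtype]
    norm_cast
    refine Finset.card_bij' (fun w _ => w - w₁) (fun w _ => w + w₁) ?_ ?_ ?_ ?_
    · intro w hw
      simp only [Finset.mem_filter, Finset.mem_univ, true_and] at hw ⊢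
      have := hC _ hw _ hw₁ _ h₀
      simpa [AddSubgroup.mem_comap, IsCoset.mem_subgroup, add_comm] using this
    · intro w hw
      simp only [Finset.mem_filter, Finset.mem_univ, true_and, AddSubgroup.mem_comap,
        IsCoset.mem_subgroup] at hw ⊢
      have := hC _ hw _ h₀ _ hw₁
      simpa using this
    · simp
    · simp
  · exact Finset.sum_eq_zero fun w _ => if_neg fun hw => hv ⟨w, hw⟩

/-- Orthogonality gives |M| where φ v vanishes and 0 elsewhere; since φ is affine in v, this zero
locus is a coset. -/
theorem sum_stdAddChar {B : Type*} [AddCommGroup B] [Module (ZMod p) B] [Fintype B]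
    (M : AddSubgroup B) [Fintype M] (φ : V → M →+ ZMod p)
    (hφ : ∀ x y z b, φ (x - y + z) b = φ x b - φ y b + φ z b) :
    IsFlat p fun v => ∑ b : M, (ZMod.stdAddChar (φ v b) : ℂ) := by
  classical
  obtain ⟨d, hd⟩ := card_addSubgroup_eq_pow (p := p) M
  refine ⟨d, {v | ∀ b, φ v b = 0}, ?_, fun v => ?_⟩
  · intro x hx y hy z hz b
    rw [hφ, hx b, hy b, hz b, sub_zero, add_zero]
  · beta_reduce
    rw [StabTheory.sum_stdAddChar, ← Nat.card_eq_fintype_card, hd, zpow_natCast, Nat.cast_pow]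
    by_cases h : ∀ b, φ v b = 0
    · rw [if_pos h, if_pos (show v ∈ {v | ∀ b, φ v b = 0} from h)]
    · rw [if_neg h, if_neg (show v ∉ {v | ∀ b, φ v b = 0} from h)]

/-- A matrix product is a pullback to triples, a product, and a sum over the middle variable, each
of which preserves flatness. -/
theorem comp_relation {U : Type*} [AddCommGroup U] [Module (ZMod p) V] [Fintype V]
    {F : U × V → ℂ} {G : V × W → ℂ} (hF : IsFlat p F) (hG : IsFlat p G) :
    IsFlat p fun q : U × W => ∑ v, F (q.1, v) * G (v, q.2) :=
  IsFlat.sum (F := fun r : (U × W) × V => F (r.1.1, r.2) * G (r.2, r.1.2))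
    ((hF.comp_prodMap (AddMonoidHom.fst U W) (AddMonoidHom.id V)).mul
      (hG.comp_hom ((AddMonoidHom.snd (U × W) V).prod
        ((AddMonoidHom.snd U W).comp (AddMonoidHom.fst (U × W) V)))))

end IsFlat

end StabTheory

end

noncomputable section

namespace StabTheory

variable {p : ℕ} [Fact p.Prime] {n m : ℕ}

/-! ## Wigner functions of stabiliser states -/

/-- The two orders of multiplication carry the phases ∓ω(b, b')/2, which differ unless the form
vanishes. -/
theorem symp_eq_zero_of_commute (hp : p ≠ 2) {t t' : ZMod p} {b b' : Phase p n}
    (hc : pauli t b * pauli t' b' = pauli t' b' * pauli t b) : symp b b' = 0 := by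
  simp only [pauli_mul hp] at hc
  have h := (pauli_injective hp hc).1
  rw [symp_comm b' b] at h
  have h2 := two_ne_zero_of_odd hp
  field_simp at h
  have h3 : (2 : ZMod p) * symp b b' = 0 := by linear_combination -h
  simpa [h2] using h3

/-- The labels of the Pauli operators in a group. -/
def labelGroup (hp : p ≠ 2) (S : Subgroup (Matrix.unitaryGroup (Reg p n) ℂ))
    (hS : IsStabiliserCode S) : AddSubgroup (ZMod p × Phase p n) where
  carrier := {q | ∃ U ∈ S, (U : Matrix (Reg p n) (Reg p n) ℂ) = pauli q.1 q.2}
  zero_mem' := ⟨1, one_mem _, by simp [pauli_zero]⟩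
  add_mem' := by
    rintro ⟨t, b⟩ ⟨t', b'⟩ ⟨U, hU, e⟩ ⟨U', hU', e'⟩
    refine ⟨U * U', mul_mem hU hU', ?_⟩
    have hc := congrArg Subtype.val (hS.2.1 U hU U' hU')
    simp only [Submonoid.coe_mul] at hc ⊢
    rw [e, e'] at hc ⊢
    rw [pauli_mul hp, symp_eq_zero_of_commute hp hc, mul_zero, sub_zero]
    rfl
  neg_mem' := by
    rintro ⟨t, b⟩ ⟨U, hU, e⟩
    refine ⟨U⁻¹, inv_mem hU, ?_⟩
    change (U : Matrix (Reg p n) (Reg p n) ℂ)ᴴ = _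
    rw [e, pauli_conjTranspose hp]
    rfl

section Label

variable (hp : p ≠ 2) {S : Subgroup (Matrix.unitaryGroup (Reg p n) ℂ)} (hS : IsStabiliserCode S)
include hp

theorem symp_labelGroup {x y : ZMod p × Phase p n} (hx : x ∈ labelGroup hp S hS)
    (hy : y ∈ labelGroup hp S hS) : symp x.2 y.2 = 0 := by
  obtain ⟨U, hU, e⟩ := hx
  obtain ⟨V, hV, e'⟩ := hy
  have hc := congrArg Subtype.val (hS.2.1 U hU V hV)
  simp only [Submonoid.coe_mul, e, e'] at hc
  exact symp_eq_zero_of_commute hp hc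

theorem labelGroup_fst_eq_zero {t : ZMod p} (h : (t, (0 : Phase p n)) ∈ labelGroup hp S hS) :
    t = 0 := by
  obtain ⟨U, hU, e⟩ := h
  exact (hS.2.2 t).1 ⟨U, hU, by rw [e, pauli_zero]⟩

theorem labelGroup_snd_injOn {x y : ZMod p × Phase p n} (hx : x ∈ labelGroup hp S hS)
    (hy : y ∈ labelGroup hp S hS) (h : x.2 = y.2) : x = y := by
  have h1 := sub_mem hx hy
  have h2 : x - y = (x.1 - y.1, 0) := Prod.ext rfl (by simp [h])
  rw [h2] at h1
  exact Prod.ext (sub_eq_zero.1 (labelGroup_fst_eq_zero hp hS h1)) h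

/-- Maximality makes the labels Lagrangian: if b is orthogonal to every label but lies under none,
adjoining π(0, b) gives a strictly larger stabiliser code. -/
theorem exists_mem_labelGroup (hmax : IsStabiliserGroup S) {b : Phase p n}
    (hb : ∀ x ∈ labelGroup hp S hmax.prop, symp x.2 b = 0) :
    ∃ t, (t, b) ∈ labelGroup hp S hmax.prop := by
  by_contra hnot
  set N := labelGroup hp S hmax.prop with hN
  have hsymp (k l : ZMod p) {x y : ZMod p × Phase p n} (hx : x ∈ N) (hy : y ∈ N) :
      symp (x.2 + k • b) (y.2 + l • b) = 0 := by
    simp only [symp_add_left, symp_add_right, symp_smul_left, symp_smul_right, symp_self,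
      symp_labelGroup hp hmax.prop hx hy, hb x hx, symp_comm b, hb y hy]
    simp
  let T : Subgroup (Matrix.unitaryGroup (Reg p n) ℂ) :=
    { carrier := {U | ∃ (k : ZMod p) (x : ZMod p × Phase p n), x ∈ N ∧
        (U : Matrix (Reg p n) (Reg p n) ℂ) = pauli x.1 (x.2 + k • b)}
      one_mem' := ⟨0, 0, zero_mem _, by simp [pauli_zero]⟩
      mul_mem' := by
        rintro U V ⟨k, x, hx, e⟩ ⟨l, y, hy, e'⟩
        refine ⟨k + l, x + y, add_mem hx hy, ?_⟩
        rw [Submonoid.coe_mul, e, e', pauli_mul hp, hsymp k l hx hy, mul_zero, sub_zero,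
          Prod.fst_add, Prod.snd_add, add_smul]
        congr 1; abel
      inv_mem' := by
        rintro U ⟨k, x, hx, e⟩
        refine ⟨-k, -x, neg_mem hx, ?_⟩
        change (U : Matrix (Reg p n) (Reg p n) ℂ)ᴴ = _
        rw [e, pauli_conjTranspose hp, Prod.fst_neg, Prod.snd_neg, neg_smul, neg_add] }
  have hT : IsStabiliserCode T := by
    refine ⟨?_, ?_, fun a => ⟨?_, ?_⟩⟩
    · rintro U ⟨k, x, -, e⟩
      exact ⟨_, _, e⟩
    · rintro U ⟨k, x, hx, e⟩ V ⟨l, y, hy, e'⟩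
      refine Subtype.ext ?_
      rw [Submonoid.coe_mul, Submonoid.coe_mul, e, e', pauli_mul hp, pauli_mul hp,
        hsymp k l hx hy, hsymp l k hy hx, add_comm x.1, add_comm (x.2 + _)]
    · rintro ⟨U, ⟨k, x, hx, e⟩, e'⟩
      rw [e', ← pauli_zero] at e
      obtain ⟨rfl, h2⟩ := pauli_injective hp e
      by_cases hk : k = 0
      · subst hk
        rw [zero_smul, add_zero] at h2
        refine labelGroup_fst_eq_zero hp hmax.prop (?_ : (x.1, 0) ∈ N)
        rw [h2]; exact hx
      -- A scalar with k ≠ 0 forces x.2 = -k b, so rescaling x yields a label over b.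
      · refine absurd ⟨(-k⁻¹) * x.1, ?_⟩ hnot
        have h3 := Submodule.smul_mem (AddSubgroup.toZModSubmodule p N) (-k⁻¹) hx
        have h4 : (-k⁻¹) • x = ((-k⁻¹) * x.1, b) := by
          refine Prod.ext rfl ?_
          rw [Prod.smul_snd, eq_neg_of_add_eq_zero_left h2.symm, smul_neg, neg_smul, neg_neg,
            smul_smul, inv_mul_cancel₀ hk, one_smul]
        rwa [h4] at h3
    · rintro rfl
      exact ⟨1, one_mem T, by simp⟩
  have hle : S ≤ T := by
    intro U hU
    obtain ⟨t, c, e⟩ := hmax.prop.1 U hU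
    exact ⟨0, (t, c), ⟨U, hU, e⟩, by simpa using e⟩
  have hmem : (⟨pauli 0 b, pauli_mem_unitaryGroup hp 0 b⟩ :
      Matrix.unitaryGroup (Reg p n) ℂ) ∈ T := ⟨1, 0, zero_mem _, by simp⟩
  exact hnot ⟨0, _, hmax.le_of_ge hT hle hmem, rfl⟩

end Label

/-- The expectation of π(0, b) in the state is ξ(-t) when (t, b) is a label and 0 otherwise. The
Wigner function is therefore a character sum over the label group. -/
theorem isFlat_wigner_of_isStabiliserState (hp : p ≠ 2) {ψ : Reg p n → ℂ}
    (hψ : IsStabiliserState ψ) : IsFlat p (wigner (Matrix.vecMulVec ψ (star ψ))) := by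
  classical
  obtain ⟨hnorm, S, hS, hfix⟩ := hψ
  set ρ := Matrix.vecMulVec ψ (star ψ) with hρ
  set N := labelGroup hp S hS.prop with hN
  have htr : ρ.trace = 1 := by
    rw [hρ, Matrix.trace_vecMulVec, dotProduct]
    have : (∑ i, ψ i * star ψ i) = ((∑ i, ‖ψ i‖ ^ 2 : ℝ) : ℂ) := by
      push_cast
      exact Finset.sum_congr rfl fun i _ => RCLike.mul_conj _
    rw [this, hnorm, Complex.ofReal_one]
  have hfixρ {x : ZMod p × Phase p n} (hx : x ∈ N) : pauli x.1 x.2 * ρ = ρ := by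
    obtain ⟨U, hU, e⟩ := hx
    rw [hρ, Matrix.mul_vecMulVec, ← e, hfix U hU]
  have hρH : ρᴴ = ρ := by rw [hρ, Matrix.conjTranspose_vecMulVec, star_star]
  have hmem {x : ZMod p × Phase p n} (hx : x ∈ N) :
      (pauli 0 x.2 * ρ).trace = ZMod.stdAddChar (-x.1) := by
    have h : pauli 0 x.2 = (ZMod.stdAddChar (-x.1) : ℂ) • pauli x.1 x.2 := by
      rw [pauli_eq_smul x.1, smul_smul, ← AddChar.map_add_eq_mul, neg_add_cancel,
        AddChar.map_zero_eq_one, one_smul]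
    rw [h, Matrix.smul_mul, hfixρ hx, Matrix.trace_smul, htr, smul_eq_mul, mul_one]
  -- Some stabiliser commutes with π(0, b) only up to a nontrivial phase. Conjugating by it fixes ρ
  -- but multiplies the trace by that phase, so the trace is 0.
  have hnot {b : Phase p n} (hb : ¬∃ t, (t, b) ∈ N) : (pauli 0 b * ρ).trace = 0 := by
    have : ∃ x ∈ N, symp x.2 b ≠ 0 := by
      by_contra! h
      exact hb (exists_mem_labelGroup hp hS h)
    obtain ⟨x, hx, hxb⟩ := this
    have h1 : (pauli 0 b * ρ).trace = ZMod.stdAddChar (symp x.2 b) * (pauli 0 b * ρ).trace := by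
      have h2 : ρ = pauli x.1 x.2 * ρ * (pauli x.1 x.2)ᴴ := by
        have := congrArg Matrix.conjTranspose (hfixρ hx)
        rw [Matrix.conjTranspose_mul, hρH] at this
        rw [hfixρ hx, this]
      have h3 : (pauli x.1 x.2)ᴴ * pauli 0 b * pauli x.1 x.2 =
          (ZMod.stdAddChar (symp x.2 b) : ℂ) • pauli 0 b := by
        rw [pauli_conjTranspose hp, pauli_mul hp, pauli_mul hp, ← pauli_eq_smul]
        have h2 := two_ne_zero_of_odd hp
        congr 1
        · simp only [symp_add_left, symp_neg_left, symp_self, symp_comm b]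
          field_simp
          ring
        · abel
      calc (pauli 0 b * ρ).trace
          = (pauli 0 b * (pauli x.1 x.2 * ρ * (pauli x.1 x.2)ᴴ)).trace := by rw [← h2]
        _ = ((pauli x.1 x.2)ᴴ * pauli 0 b * pauli x.1 x.2 * ρ).trace := by
            rw [← Matrix.mul_assoc, Matrix.trace_mul_comm]
            simp only [Matrix.mul_assoc]
        _ = _ := by rw [h3, Matrix.smul_mul, Matrix.trace_smul, smul_eq_mul]
    by_contra h0
    have h4 : (ZMod.stdAddChar (symp x.2 b) : ℂ) = ZMod.stdAddChar (0 : ZMod p) := by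
      rw [AddChar.map_zero_eq_one]
      exact (mul_right_cancel₀ h0 (by rw [one_mul]; exact h1)).symm
    exact hxb (ZMod.injective_stdAddChar h4)
  -- One factor p^(-n) comes from `wigner`, the other from the Pauli expansion of the phase point.
  have hsum (w : Phase p n) : wigner ρ w = (p : ℂ) ^ (-(2 * n : ℤ)) *
      ∑ x : N, (ZMod.stdAddChar (symp w x.1.2 - x.1.1) : ℂ) := by
    have h1 : ∑ b : Phase p n, (pauli (symp w b) b * ρ).trace =
        ∑ x : N, (ZMod.stdAddChar (symp w x.1.2 - x.1.1) : ℂ) := by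
      symm
      refine Finset.sum_of_injOn (fun x : N => x.1.2) ?_ ?_ ?_ ?_
      · intro x _ y _ h
        exact Subtype.ext (labelGroup_snd_injOn hp hS.prop x.2 y.2 h)
      · exact fun _ _ => Finset.mem_coe.2 (Finset.mem_univ _)
      · intro b _ hb
        rw [pauli_eq_smul, Matrix.smul_mul, Matrix.trace_smul, hnot, smul_zero]
        rintro ⟨t, ht⟩
        exact hb ⟨⟨_, ht⟩, by simp, rfl⟩
      · intro x _
        rw [pauli_eq_smul, Matrix.smul_mul, Matrix.trace_smul, hmem x.2, smul_eq_mul,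
          ← AddChar.map_add_eq_mul, ← sub_eq_add_neg]
    rw [wigner, phasePoint_eq_sum hp, Matrix.smul_mul, Finset.sum_mul, Matrix.trace_smul,
      Matrix.trace_sum, h1, smul_eq_mul, ← mul_assoc]
    congr 1
    rw [zpow_neg, two_mul, zpow_add₀ natCast_prime_ne_zero, zpow_natCast, mul_inv]
  have h := (IsFlat.sum_stdAddChar (V := Phase p n) N
    (fun w => AddMonoidHom.mk' (fun x : N => symp w x.1.2 - x.1.1) fun x y => by
      simp only [AddSubgroup.coe_add, Prod.snd_add, Prod.fst_add, symp_add_right]; ring)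
    fun x y z b => by
      simp only [AddMonoidHom.mk'_apply, symp_add_left, symp_sub_left]; ring).zpow_mul
        (-(2 * n : ℤ))
  simp only [AddMonoidHom.mk'_apply, ← hsum] at h
  exact h

end StabTheory

end

noncomputable section

namespace StabTheory

variable {p n m n' m' k : ℕ}

/-! ## Tensor products of registers and phase spaces -/

/-- The projection of a joint phase space to its first factor. -/
def phaseFst (n m : ℕ) : Phase p (n + m) →+ Phase p n where
  toFun v := (v.1 ∘ Fin.castAdd m, v.2 ∘ Fin.castAdd m)
  map_zero' := rfl
  map_add' _ _ := rfl

/-- The projection of a joint phase space to its second factor. -/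
def phaseSnd (n m : ℕ) : Phase p (n + m) →+ Phase p m where
  toFun v := (v.1 ∘ Fin.natAdd n, v.2 ∘ Fin.natAdd n)
  map_zero' := rfl
  map_add' _ _ := rfl

theorem append_comp_castAdd_natAdd (u : Reg p (n + m)) :
    Fin.append (u ∘ Fin.castAdd m) (u ∘ Fin.natAdd n) = u := Fin.append_castAdd_natAdd

theorem phase_append_fst_snd (v : Phase p (n + m)) :
    Phase.append (phaseFst n m v) (phaseSnd n m v) = v :=
  Prod.ext (append_comp_castAdd_natAdd _) (append_comp_castAdd_natAdd _)

theorem phaseFst_append (v : Phase p n) (w : Phase p m) :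
    phaseFst n m (Phase.append v w) = v := by
  refine Prod.ext ?_ ?_ <;> funext i <;> simp [phaseFst, Phase.append]

theorem phaseSnd_append (v : Phase p n) (w : Phase p m) :
    phaseSnd n m (Phase.append v w) = w := by
  refine Prod.ext ?_ ?_ <;> funext i <;> simp [phaseSnd, Phase.append]

theorem phase_append_add (v v' : Phase p n) (w w' : Phase p m) :
    Phase.append (v + v') (w + w') = Phase.append v w + Phase.append v' w' := by
  rw [← phase_append_fst_snd (Phase.append v w + Phase.append v' w'), map_add, map_add]
  simp only [phaseFst_append, phaseSnd_append]

/-- Concatenation of phase space vectors as a homomorphism. -/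
def phaseAppend (n m : ℕ) : Phase p n × Phase p m →+ Phase p (n + m) :=
  AddMonoidHom.mk' (fun q => Phase.append q.1 q.2) fun _ _ => phase_append_add _ _ _ _

theorem matrix_ext_append {A B : Matrix (Reg p (n + m)) (Reg p (n' + m')) ℂ}
    (h : ∀ i i' j j', A (Fin.append i i') (Fin.append j j') =
      B (Fin.append i i') (Fin.append j j')) : A = B := by
  ext i j
  rw [← append_comp_castAdd_natAdd i, ← append_comp_castAdd_natAdd j]
  exact h _ _ _ _

theorem tensor_conjTranspose (A : Matrix (Reg p m) (Reg p n) ℂ)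
    (B : Matrix (Reg p m') (Reg p n') ℂ) : (tensor A B)ᴴ = tensor Aᴴ Bᴴ := by
  simp only [tensor, Matrix.conjTranspose_reindex, Matrix.conjTranspose_kronecker]

theorem cup_append (i i' : Reg p n) (z : Reg p 0) :
    cup p n (Fin.append i i') z = if i = i' then 1 else 0 := by
  have h1 : (Fin.append i i' : Reg p (n + n)) ∘ Fin.castAdd n = i :=
    funext fun x => Fin.append_left i i' x
  have h2 : (Fin.append i i' : Reg p (n + n)) ∘ Fin.natAdd n = i' :=
    funext fun x => Fin.append_right i i' x
  simp only [cup, Matrix.of_apply, h1, h2]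

variable [Fact p.Prime]

/-- Phase conjugation as a homomorphism. -/
def phaseConj (n : ℕ) : Phase p n →+ Phase p n :=
  AddMonoidHom.mk' Phase.conj fun v w => by
    refine Prod.ext rfl ?_
    simp [Phase.conj, add_comm]

theorem phase_conj_conj (v : Phase p n) : v.conj.conj = v :=
  Prod.ext rfl (neg_neg _)

theorem dotProduct_append (a b : Reg p n) (c d : Reg p m) :
    Fin.append a c ⬝ᵥ Fin.append b d = a ⬝ᵥ b + c ⬝ᵥ d := by
  simp [dotProduct, Fin.sum_univ_add]

theorem symp_append (v v' : Phase p n) (w w' : Phase p m) :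
    symp (Phase.append v w) (Phase.append v' w') = symp v v' + symp w w' := by
  simp only [symp, Phase.append, dotProduct_append]; ring

theorem symp_conj (v w : Phase p n) : symp v.conj w.conj = -symp v w := by
  simp only [symp, Phase.conj, dotProduct_neg, neg_dotProduct]; ring

theorem phasePoint_append (v : Phase p n) (w : Phase p m) :
    phasePoint (Phase.append v w) = tensor (phasePoint v) (phasePoint w) := by
  refine matrix_ext_append fun i i' j j' => ?_
  have h1 (a c : Reg p n) (b d : Reg p m) :
      Fin.append a b + Fin.append c d = Fin.append (a + c) (b + d) := by
    rw [← append_comp_castAdd_natAdd (Fin.append a b + Fin.append c d)]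
    congr 1 <;> funext x <;> simp
  have h2 (a c : Reg p n) (b d : Reg p m) :
      Fin.append a b - Fin.append c d = Fin.append (a - c) (b - d) := by
    rw [← append_comp_castAdd_natAdd (Fin.append a b - Fin.append c d)]
    congr 1 <;> funext x <;> simp
  have h3 (s : ZMod p) (a : Reg p n) (b : Reg p m) :
      s • Fin.append a b = Fin.append (s • a) (s • b) := by
    rw [← append_comp_castAdd_natAdd (s • Fin.append a b)]
    congr 1 <;> funext x <;> simp
  have h4 (a c : Reg p n) (b d : Reg p m) :
      Fin.append a b = Fin.append c d ↔ a = c ∧ b = d :=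
    ⟨fun h => Prod.ext_iff.1 ((Fin.appendEquiv n m).injective (a₁ := (a, b)) (a₂ := (c, d)) h),
      by rintro ⟨rfl, rfl⟩; rfl⟩
  rw [tensor_append]
  simp only [phasePoint, Phase.append, Matrix.of_apply, h1, h2, h3, h4, dotProduct_append,
    AddChar.map_add_eq_mul]
  split_ifs <;> first | rfl | (exfalso; tauto) | simp

theorem tensor_mul_tensor {a b c a' b' c' : ℕ} (A : Matrix (Reg p a) (Reg p b) ℂ)
    (B : Matrix (Reg p b) (Reg p c) ℂ) (A' : Matrix (Reg p a') (Reg p b') ℂ)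
    (B' : Matrix (Reg p b') (Reg p c') ℂ) :
    tensor A A' * tensor B B' = tensor (A * B) (A' * B') := by
  simp only [tensor, Matrix.reindex_apply, Matrix.submatrix_mul_equiv, Matrix.mul_kronecker_mul]

theorem trace_tensor (A : Matrix (Reg p n) (Reg p n) ℂ) (B : Matrix (Reg p m) (Reg p m) ℂ) :
    (tensor A B).trace = A.trace * B.trace := by
  rw [← Matrix.trace_kronecker]
  exact Fintype.sum_equiv (Fin.appendEquiv n m).symm _ _ fun _ => rfl

theorem wigner_tensor (A : Matrix (Reg p n) (Reg p n) ℂ) (B : Matrix (Reg p m) (Reg p m) ℂ)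
    (v : Phase p (n + m)) :
    wigner (tensor A B) v = wigner A (phaseFst n m v) * wigner B (phaseSnd n m v) := by
  rw [← phase_append_fst_snd v, phaseFst_append, phaseSnd_append, wigner, phasePoint_append,
    tensor_mul_tensor, trace_tensor, wigner, wigner, pow_add, mul_inv]
  ring

theorem phasePoint_of_zero (v : Phase p 0) : phasePoint v = 1 := by
  ext i j
  obtain rfl := Subsingleton.elim i j
  rw [Matrix.one_apply_eq]
  simp only [phasePoint, Matrix.of_apply, sub_self, dotProduct_zero, AddChar.map_zero_eq_one]
  exact if_pos (Subsingleton.elim _ _)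

theorem trace_phasePoint_mul_phasePoint (hp : p ≠ 2) (v w : Phase p n) :
    (phasePoint v * phasePoint w).trace = if v = w then (p : ℂ) ^ n else 0 := by
  have h (b : Phase p n) : symp w b - symp v b = symp (w - v) b := (symp_sub_left _ _ _).symm
  rw [phasePoint_eq_sum hp w, Matrix.mul_smul, Finset.mul_sum, Matrix.trace_smul,
    Matrix.trace_sum]
  simp only [trace_phasePoint_mul_pauli hp, h, sum_stdAddChar_symp, sub_eq_zero, eq_comm (a := w),
    smul_eq_mul, mul_ite, mul_zero]
  rw [← mul_assoc, inv_mul_cancel₀ (pow_ne_zero _ natCast_prime_ne_zero), one_mul]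

/-! ## Transfer functions of stabiliser maps -/

/-- The matrix elements of `ρ ↦ A ρ A†` with respect to phase point operators. -/
def transfer (A : Matrix (Reg p m) (Reg p n) ℂ) (q : Phase p n × Phase p m) : ℂ :=
  wigner (A * phasePoint q.1 * Aᴴ) q.2

/-- Expanding the intermediate operator in phase points turns composition into a matrix product. -/
theorem transfer_mul (hp : p ≠ 2) (B : Matrix (Reg p k) (Reg p m) ℂ)
    (A : Matrix (Reg p m) (Reg p n) ℂ) (q : Phase p n × Phase p k) :
    transfer (B * A) q = ∑ v, transfer A (q.1, v) * transfer B (v, q.2) := by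
  have h : B * A * phasePoint q.1 * (B * A)ᴴ = B * (A * phasePoint q.1 * Aᴴ) * Bᴴ := by
    simp only [Matrix.conjTranspose_mul, Matrix.mul_assoc]
  rw [transfer, h, eq_sum_wigner hp (A * phasePoint q.1 * Aᴴ), Matrix.mul_sum, Matrix.sum_mul,
    wigner_sum]
  refine Finset.sum_congr rfl fun v _ => ?_
  rw [Matrix.mul_smul, Matrix.smul_mul, wigner_smul]
  rfl

theorem transfer_tensor (A : Matrix (Reg p m) (Reg p n) ℂ)
    (B : Matrix (Reg p m') (Reg p n') ℂ) (q : Phase p (n + n') × Phase p (m + m')) :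
    transfer (tensor A B) q = transfer A (phaseFst n n' q.1, phaseFst m m' q.2) *
      transfer B (phaseSnd n n' q.1, phaseSnd m m' q.2) := by
  rw [transfer, ← phase_append_fst_snd q.1, phasePoint_append, tensor_conjTranspose,
    tensor_mul_tensor, tensor_mul_tensor, wigner_tensor, phaseFst_append, phaseSnd_append]
  rfl

/-- Cyclicity of the trace swaps the two phase points; the power of p compares the Wigner
normalisations on n and m qupits. -/
theorem transfer_conjTranspose (A : Matrix (Reg p m) (Reg p n) ℂ)
    (q : Phase p m × Phase p n) :
    transfer Aᴴ q = (p : ℂ) ^ (m - n : ℤ) * transfer A (q.2, q.1) := by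
  have h0 : (p : ℂ) ^ m ≠ 0 := pow_ne_zero _ natCast_prime_ne_zero
  have h : (phasePoint q.2 * (Aᴴ * phasePoint q.1 * A)).trace =
      (phasePoint q.1 * (A * phasePoint q.2 * Aᴴ)).trace := by
    rw [← Matrix.mul_assoc, Matrix.trace_mul_comm, ← Matrix.mul_assoc, ← Matrix.mul_assoc,
      Matrix.trace_mul_comm]
  rw [transfer, transfer, wigner, wigner, Matrix.conjTranspose_conjTranspose, h,
    zpow_sub₀ natCast_prime_ne_zero, zpow_natCast, zpow_natCast]
  field_simp

theorem isFlat_transfer_scalar (c : ℂ) (d : ℤ) (hc : c * star c = (p : ℂ) ^ d) :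
    IsFlat p (transfer (c • (1 : Matrix (Reg p 0) (Reg p 0) ℂ))) := by
  refine ⟨d, Set.univ, fun _ _ _ _ _ _ => trivial, fun q => ?_⟩
  rw [if_pos (Set.mem_univ _), transfer, wigner, phasePoint_of_zero, phasePoint_of_zero, ← hc,
    Matrix.conjTranspose_smul]
  simp [Matrix.trace_smul, mul_comm]

theorem isFlat_transfer_cup (hp : p ≠ 2) (n : ℕ) : IsFlat p (transfer (cup p n)) := by
  -- The cup transposes one leg, leaving the trace of two phase points: p^n on the diagonal, divided
  -- by p^(2n) for 2n qupits.
  refine ⟨-n, {q | phaseFst n n q.2 = (phaseSnd n n q.2).conj}, ?_, fun q => ?_⟩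
  · intro x hx y hy z hz
    have hx' : phaseFst n n x.2 = phaseConj n (phaseSnd n n x.2) := hx
    have hy' : phaseFst n n y.2 = phaseConj n (phaseSnd n n y.2) := hy
    have hz' : phaseFst n n z.2 = phaseConj n (phaseSnd n n z.2) := hz
    change phaseFst n n (x.2 - y.2 + z.2) = phaseConj n (phaseSnd n n (x.2 - y.2 + z.2))
    simp only [map_add, map_sub, hx', hy', hz']
  · have hcc (i i' j j' : Reg p n) : (cup p n * (cup p n)ᴴ) (Fin.append i i') (Fin.append j j') =
        (if i = i' then 1 else 0) * (if j = j' then 1 else 0) := by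
      rw [Matrix.mul_apply]
      refine (Fintype.sum_subsingleton _ (0 : Reg p 0)).trans ?_
      rw [Matrix.conjTranspose_apply, cup_append, cup_append]
      split_ifs <;> simp
    have htr (v w : Phase p n) : (phasePoint (Phase.append v w) * (cup p n * (cup p n)ᴴ)).trace =
        (phasePoint v * phasePoint w.conj).trace := by
      rw [phasePoint_append, ← phasePoint_transpose]
      simp only [Matrix.trace, Matrix.diag_apply, Matrix.mul_apply (M := tensor _ _),
        Matrix.mul_apply (M := phasePoint v), sum_append, tensor_append, hcc]
      refine Finset.sum_congr rfl fun i _ => ?_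
      simp [Finset.sum_ite_eq, mul_ite]
    have h0 : (p : ℂ) ^ n ≠ 0 := pow_ne_zero _ natCast_prime_ne_zero
    rw [transfer, phasePoint_of_zero, Matrix.mul_one, ← phase_append_fst_snd q.2, wigner, htr,
      trace_phasePoint_mul_phasePoint hp]
    simp only [Set.mem_ofPred_eq]
    split_ifs
    · rw [pow_add, zpow_neg, zpow_natCast]
      field_simp
    · rw [mul_zero]

/-- Conjugation by U takes π(0, b) to π(c b, g b) with c and g additive, so each entry is a sum of
characters of b whose exponents depend affinely on the two phase points. -/
theorem isFlat_transfer_clifford (hp : p ≠ 2) {U : Matrix (Reg p n) (Reg p n) ℂ}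
    (hU : IsClifford U) : IsFlat p (transfer U) := by
  classical
  have h2 := two_ne_zero_of_odd hp
  have hUU : Uᴴ * U = 1 := Matrix.mem_unitaryGroup_iff'.1 hU.1
  choose c g hcg using fun b : Phase p n => hU.2 (pauli 0 b) ⟨0, b, rfl⟩
  have hconj (t : ZMod p) (b : Phase p n) : U * pauli t b * Uᴴ = pauli (t + c b) (g b) := by
    rw [pauli_eq_smul t, Matrix.mul_smul, Matrix.smul_mul, hcg, pauli_eq_smul (c b), smul_smul,
      ← AddChar.map_add_eq_mul, ← pauli_eq_smul]
  have hadd (b b' : Phase p n) : -(2⁻¹ * symp b b') + c (b + b') =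
      c b + c b' - 2⁻¹ * symp (g b) (g b') ∧ g (b + b') = g b + g b' := by
    have h : U * (pauli 0 b * pauli 0 b') * Uᴴ =
        (U * pauli 0 b * Uᴴ) * (U * pauli 0 b' * Uᴴ) := by
      calc _ = U * pauli 0 b * 1 * pauli 0 b' * Uᴴ := by simp only [Matrix.mul_assoc, one_mul]
        _ = _ := by rw [← hUU]; simp only [Matrix.mul_assoc]
    rw [pauli_mul hp, hconj, hcg, hcg, pauli_mul hp] at h
    simpa using pauli_injective hp h
  -- Exchanging b and b' negates both symplectic terms; adding the two identities removes them.
  have hc (b b' : Phase p n) : c (b + b') = c b + c b' := by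
    have h3 := (hadd b b').1
    have h4 := (hadd b' b).1
    rw [add_comm b' b, symp_comm b' b, symp_comm (g b') (g b)] at h4
    have h5 : (2 : ZMod p) * (c (b + b') - (c b + c b')) = 0 := by
      linear_combination h3 + h4
    simpa [h2, sub_eq_zero] using h5
  have hsum (q : Phase p n × Phase p n) : transfer U q = (p : ℂ) ^ (-(2 * n : ℤ)) *
      ∑ b : (⊤ : AddSubgroup (Phase p n)),
        (ZMod.stdAddChar (symp q.1 b.1 + c b.1 - symp q.2 (g b.1)) : ℂ) := by
    have h3 : ∑ b : (⊤ : AddSubgroup (Phase p n)),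
        (ZMod.stdAddChar (symp q.1 b.1 + c b.1 - symp q.2 (g b.1)) : ℂ) =
        ∑ b : Phase p n, ZMod.stdAddChar (symp q.1 b + c b - symp q.2 (g b)) :=
      Fintype.sum_equiv AddSubgroup.topEquiv.toEquiv _ _ fun _ => rfl
    rw [h3, transfer, phasePoint_eq_sum hp q.1, Matrix.mul_smul, Matrix.smul_mul, wigner_smul,
      Finset.mul_sum, Finset.sum_mul, wigner_sum]
    simp only [hconj, wigner_pauli hp, ← Finset.mul_sum]
    rw [← mul_assoc]
    congr 1
    rw [zpow_neg, two_mul, zpow_add₀ natCast_prime_ne_zero, zpow_natCast, mul_inv]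
  have h := (IsFlat.sum_stdAddChar (V := Phase p n × Phase p n) (⊤ : AddSubgroup (Phase p n))
    (fun q => AddMonoidHom.mk' (fun b => symp q.1 b.1 + c b.1 - symp q.2 (g b.1)) fun x y => by
      simp only [AddSubgroup.coe_add, hc, (hadd _ _).2, symp_add_right]; ring)
    fun x y z b => by
      simp only [AddMonoidHom.mk'_apply, Prod.fst_add, Prod.snd_add, Prod.fst_sub, Prod.snd_sub,
        symp_add_left, symp_sub_left]; ring).zpow_mul (-(2 * n : ℤ))
  simp only [AddMonoidHom.mk'_apply, ← hsum] at h
  exact h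

theorem isFlat_transfer (hp : p ≠ 2) {A : Matrix (Reg p m) (Reg p n) ℂ} (hA : IsStab A) :
    IsFlat p (transfer A) := by
  induction hA with
  | state ψ h =>
    have e : transfer (Matrix.of fun i (_ : Reg p 0) => ψ i) =
        fun q => wigner (Matrix.vecMulVec ψ (star ψ)) (AddMonoidHom.snd _ _ q) := by
      funext q
      rw [transfer, phasePoint_of_zero, Matrix.mul_one]
      congr 1
      ext i j
      rw [Matrix.mul_apply]
      exact Fintype.sum_subsingleton _ (0 : Reg p 0)
    rw [e]
    exact (isFlat_wigner_of_isStabiliserState hp h).comp_hom _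
  | clifford U h => exact isFlat_transfer_clifford hp h
  | sqrt =>
    refine isFlat_transfer_scalar _ 1 ?_
    rw [RCLike.star_def, Complex.conj_ofReal, ← Complex.ofReal_mul,
      Real.mul_self_sqrt (Nat.cast_nonneg _)]
    simp
  | invSqrt =>
    refine isFlat_transfer_scalar _ (-1) ?_
    rw [RCLike.star_def, Complex.conj_ofReal, ← Complex.ofReal_mul, ← mul_inv,
      Real.mul_self_sqrt (Nat.cast_nonneg _)]
    simp
  | cup n => exact isFlat_transfer_cup hp n
  | comp B A _ _ hB hA =>
    rw [show transfer (B * A) = _ from funext fun q => transfer_mul hp B A q]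
    exact hA.comp_relation hB
  | @tensor n m n' m' A B _ _ hA hB =>
    rw [show transfer (StabTheory.tensor A B) = _ from funext fun q => transfer_tensor A B q]
    exact (hA.comp_prodMap (phaseFst n n') (phaseFst m m')).mul
      (hB.comp_prodMap (phaseSnd n n') (phaseSnd m m'))
  | dagger A _ hA =>
    rw [show transfer Aᴴ = _ from funext fun q => transfer_conjTranspose A q]
    exact hA.comp_swap.zpow_mul _

end StabTheory

end

noncomputable section

namespace StabTheory

open scoped ComplexOrder

variable {p n : ℕ} [Fact p.Prime]

/-! ## Operators whose Wigner function is flat -/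

/-- The squared Hilbert–Schmidt norm of UF - F is 2 tr(FF†) - 2 Re tr(UFF†), which the hypothesis
makes zero. -/
theorem mul_eq_self_of_trace_eq {ι κ : Type*} [Fintype ι] [Fintype κ] [DecidableEq ι]
    {U : Matrix ι ι ℂ} (hU : Uᴴ * U = 1) {F : Matrix ι κ ℂ}
    (h : (U * (F * Fᴴ)).trace = (F * Fᴴ).trace) : U * (F * Fᴴ) = F * Fᴴ := by
  have h1 : (Fᴴ * U * F).trace = (F * Fᴴ).trace := by
    rw [← h, Matrix.mul_assoc, Matrix.trace_mul_comm, Matrix.mul_assoc]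
  have h2 : (Fᴴ * Uᴴ * F).trace = (F * Fᴴ).trace := by
    have h3 : Fᴴ * Uᴴ * F = (Fᴴ * U * F)ᴴ := by
      simp only [Matrix.conjTranspose_mul, Matrix.conjTranspose_conjTranspose, Matrix.mul_assoc]
    rw [h3, Matrix.trace_conjTranspose, h1, ← Matrix.trace_conjTranspose,
      Matrix.conjTranspose_mul, Matrix.conjTranspose_conjTranspose]
  have h4 : ((U * F - F)ᴴ * (U * F - F)).trace = 0 := by
    have h5 : (U * F - F)ᴴ * (U * F - F) =
        Fᴴ * (Uᴴ * U) * F - Fᴴ * Uᴴ * F - Fᴴ * U * F + Fᴴ * F := by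
      simp only [Matrix.conjTranspose_sub, Matrix.conjTranspose_mul, Matrix.sub_mul,
        Matrix.mul_sub, Matrix.mul_assoc]
      abel
    rw [h5, hU, Matrix.mul_one, Matrix.trace_add, Matrix.trace_sub, Matrix.trace_sub, h1, h2,
      Matrix.trace_mul_comm Fᴴ F]
    ring
  rw [Matrix.trace_conjTranspose_mul_self_eq_zero_iff, sub_eq_zero] at h4
  rw [← Matrix.mul_assoc, h4]

/-- The symplectic complement as a subgroup. -/
def sympComplementSubgroup (L : Set (Phase p n)) : AddSubgroup (Phase p n) where
  carrier := sympComplement L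
  zero_mem' s _ := symp_zero_left s
  add_mem' hx hy s hs := by rw [symp_add_left, hx s hs, hy s hs, add_zero]
  neg_mem' hx s hs := by rw [symp_neg_left, hx s hs, neg_zero]

/-! ### Code groups and their projectors -/

theorem symp_eq_of_mem {C : Set (Phase p n)} {a b c : Phase p n} (ha : a ∈ C) (hc : c ∈ C)
    (hb : b ∈ sympComplement (linearComponent C)) : symp a b = symp c b := by
  have h := hb (a - c) ⟨a, ha, c, hc, rfl⟩
  rwa [symp_comm, neg_eq_zero, symp_sub_left, sub_eq_zero] at h

theorem mem_codeGroup {C : Set (Phase p n)} {a : Phase p n} (ha : a ∈ C)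
    {g : ZMod p × Phase p n} :
    g ∈ codeGroup C ↔ g.2 ∈ sympComplement (linearComponent C) ∧ g.1 = symp a g.2 := by
  constructor
  · rintro (⟨c, hc, hg, e⟩ | ⟨rfl, -⟩)
    · exact ⟨hg, e.trans (symp_eq_of_mem hc ha hg)⟩
    · exact absurd ha (Set.notMem_empty _)
  · rintro ⟨hg, e⟩
    exact Or.inl ⟨a, ha, hg, e⟩

theorem zero_mem_codeGroup (C : Set (Phase p n)) : (0, 0) ∈ codeGroup C := by
  obtain rfl | ⟨a, ha⟩ := C.eq_empty_or_nonempty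
  · exact Or.inr ⟨rfl, rfl⟩
  · exact (mem_codeGroup ha).2
      ⟨zero_mem (sympComplementSubgroup (linearComponent C)), (symp_zero_right a).symm⟩

theorem codeGroup_eq_image {C : Set (Phase p n)} {a : Phase p n} (ha : a ∈ C) :
    codeGroup C = (fun b => (symp a b, b)) '' sympComplement (linearComponent C) := by
  ext ⟨t, b⟩
  rw [mem_codeGroup ha]
  constructor
  · rintro ⟨hb, e⟩
    exact ⟨b, hb, Prod.ext e.symm rfl⟩
  · rintro ⟨c, hc, e⟩
    obtain ⟨rfl, rfl⟩ := Prod.ext_iff.1 e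
    exact ⟨hc, rfl⟩

/-- The group of the empty set consists of all scalars ξ(t), whose sum vanishes. -/
theorem codeProjector_empty : codeProjector (∅ : Set (Phase p n)) = 0 := by
  have h : ∑ t : ZMod p, (ZMod.stdAddChar t : ℂ) = 0 := by
    classical
    have := sum_stdAddChar (AddMonoidHom.id (ZMod p))
    simp only [AddMonoidHom.id_apply] at this
    rw [this, if_neg]
    exact fun h => one_ne_zero (h 1)
  have e (g : ZMod p × Phase p n) : g ∈ codeGroup (∅ : Set (Phase p n)) ↔ g.2 = 0 := by
    simp [codeGroup]
  have h2 (t : ZMod p) : (∑ b : Phase p n, if b = 0 then pauli t b else 0) =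
      (ZMod.stdAddChar t : ℂ) • 1 := by
    rw [Finset.sum_ite_eq' Finset.univ, if_pos (Finset.mem_univ _), pauli_zero]
  rw [codeProjector, Finset.sum_filter, Fintype.sum_prod_type]
  simp only [e, h2, ← Finset.sum_smul, h, zero_smul, smul_zero]

theorem codeProjector_mul_eq_self {C : Set (Phase p n)} {M : Matrix (Reg p n) (Reg p n) ℂ}
    (h : ∀ g ∈ codeGroup C, pauli g.1 g.2 * M = M) : codeProjector C * M = M := by
  classical
  have h0 : ((codeGroup C).ncard : ℂ) ≠ 0 := by
    exact_mod_cast (Set.ncard_ne_zero_of_mem (zero_mem_codeGroup C))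
  rw [codeProjector, Matrix.smul_mul, Finset.sum_mul,
    Finset.sum_congr rfl fun g hg => h g (Finset.mem_filter.1 hg).2, Finset.sum_const,
    ← Nat.cast_smul_eq_nsmul ℂ, smul_smul, ← Set.ncard_coe_finset]
  have e : ((Finset.univ.filter fun g => g ∈ codeGroup C : Finset (ZMod p × Phase p n)) :
      Set (ZMod p × Phase p n)) = codeGroup C := by
    ext; simp
  rw [e, inv_mul_cancel₀ h0, one_smul]

/-- The operator `J` is a power of `p` times the projector of a stabiliser code, described by the
coset `C`. -/
structure IsCode (C : Set (Phase p n)) (J : Matrix (Reg p n) (Reg p n) ℂ) : Prop where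
  stabilisedSpace_eq : stabilisedSpace J = C
  eq_smul : ∃ d : ℤ, J = (p : ℂ) ^ d • codeProjector C
  pauli_mul_eq {g : ZMod p × Phase p n} : g ∈ codeGroup C → pauli g.1 g.2 * J = J
  add_mem {a b : Phase p n} : a ∈ C → b ∈ sympComplement (linearComponent C) → a + b ∈ C
  isHermitian : Jᴴ = J

theorem isCode_zero : IsCode (∅ : Set (Phase p n)) 0 where
  stabilisedSpace_eq := by
    refine Set.eq_empty_of_forall_notMem fun v hv => ?_
    have h0 := hv 0 0 (Matrix.mul_zero _)
    have h1 := hv 1 0 (Matrix.mul_zero _)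
    exact one_ne_zero (h1.trans h0.symm)
  eq_smul := ⟨0, by rw [codeProjector_empty, smul_zero]⟩
  pauli_mul_eq _ := Matrix.mul_zero _
  add_mem ha := absurd ha (Set.notMem_empty _)
  isHermitian := Matrix.conjTranspose_zero

open Classical in
-- Write J as p^k times the sum of A_v over C, expand in Pauli operators and exchange the sums: the
-- character sum over C kills every b outside L^ω. Positivity plays no role yet.
theorem eq_smul_sum_pauli (hp : p ≠ 2) {J : Matrix (Reg p n) (Reg p n) ℂ} {C : Set (Phase p n)}
    (hC : IsCoset C) {a : Phase p n} (ha : a ∈ C) {k : ℤ}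
    (hJ : ∀ v, wigner J v = if v ∈ C then (p : ℂ) ^ k else 0) :
    ∃ d : ℤ, J = (p : ℂ) ^ d • ∑ b : Phase p n with b ∈ sympComplement (linearComponent C),
      pauli (symp a b) b := by
  obtain ⟨e, he⟩ := card_addSubgroup_eq_pow (p := p) (hC.subgroup ha)
  have hmem (b : Phase p n) : b ∈ sympComplement (linearComponent C) ↔
      ∀ l : hC.subgroup ha, symp l.1 b = 0 := by
    constructor
    · intro hb l
      have := hb l.1 ⟨a + l.1, l.2, a, ha, (add_sub_cancel_left a l.1).symm⟩
      rwa [symp_comm, neg_eq_zero] at this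
    · rintro hb _ ⟨x, hx, y, hy, rfl⟩
      rw [symp_comm, neg_eq_zero]
      refine hb ⟨x - y, ?_⟩
      rw [hC.mem_subgroup, add_comm]
      exact hC _ hx _ hy _ ha
  have hsum (b : Phase p n) : ∑ v : Phase p n with v ∈ C, (ZMod.stdAddChar (symp v b) : ℂ) =
      if b ∈ sympComplement (linearComponent C) then (p : ℂ) ^ e * ZMod.stdAddChar (symp a b)
      else 0 := by
    have h1 : ∑ v : Phase p n with v ∈ C, (ZMod.stdAddChar (symp v b) : ℂ) =
        ∑ l : hC.subgroup ha, (ZMod.stdAddChar (symp (a + l.1) b) : ℂ) := by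
      symm
      refine Finset.sum_bij (fun l _ => a + l.1) ?_ ?_ ?_ ?_
      · exact fun l _ => Finset.mem_filter.2 ⟨Finset.mem_univ _, l.2⟩
      · exact fun l _ l' _ h => Subtype.ext (add_left_cancel h)
      · intro v hv
        refine ⟨⟨v - a, ?_⟩, Finset.mem_univ _, add_sub_cancel a v⟩
        rw [hC.mem_subgroup, add_sub_cancel]
        exact (Finset.mem_filter.1 hv).2
      · exact fun _ _ => rfl
    have h2 := sum_stdAddChar (AddMonoidHom.mk' (fun l : hC.subgroup ha => symp l.1 b)
      fun x y => symp_add_left x.1 y.1 b)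
    simp only [AddMonoidHom.mk'_apply, ← hmem b, ← Nat.card_eq_fintype_card, he] at h2
    simp only [h1, symp_add_left, AddChar.map_add_eq_mul, ← Finset.mul_sum, h2]
    split_ifs
    · rw [mul_comm, Nat.cast_pow]
    · rw [mul_zero]
  -- Here k is the Wigner exponent, -n comes from the expansion of phase points, and p^e is the
  -- order of the direction of C.
  refine ⟨k - n + e, ?_⟩
  have h1 : J = (p : ℂ) ^ k • ∑ v : Phase p n with v ∈ C, phasePoint v := by
    conv_lhs => rw [eq_sum_wigner hp J]
    simp only [hJ, ite_smul, zero_smul, ← Finset.sum_filter, ← Finset.smul_sum]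
  simp only [phasePoint_eq_sum hp, ← Finset.smul_sum] at h1
  rw [Finset.sum_comm] at h1
  have h2 (b : Phase p n) : ∑ v : Phase p n with v ∈ C, pauli (symp v b) b =
      if b ∈ sympComplement (linearComponent C) then (p : ℂ) ^ e • pauli (symp a b) b else 0 := by
    rw [Finset.sum_congr rfl fun v _ => pauli_eq_smul (symp v b) b, ← Finset.sum_smul, hsum]
    split_ifs
    · rw [pauli_eq_smul (symp a b), smul_smul]
    · rw [zero_smul]
  simp only [h2, ← Finset.sum_filter, ← Finset.smul_sum] at h1
  rw [h1, smul_smul, smul_smul]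
  congr 1
  rw [zpow_add₀ natCast_prime_ne_zero, zpow_sub₀ natCast_prime_ne_zero, zpow_natCast,
    zpow_natCast, div_eq_mul_inv]

open Classical in
theorem trace_pauli_mul_sum_pauli (hp : p ≠ 2) {C : Set (Phase p n)} (a : Phase p n)
    (t : ZMod p) (b : Phase p n) :
    (pauli t b * ∑ c : Phase p n with c ∈ sympComplement (linearComponent C),
      pauli (symp a c) c).trace =
      if b ∈ sympComplement (linearComponent C) then (p : ℂ) ^ n * ZMod.stdAddChar (t - symp a b)
      else 0 := by
  rw [Finset.mul_sum, Matrix.trace_sum]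
  have h (c : Phase p n) : (pauli t b * pauli (symp a c) c).trace =
      if -b = c then (p : ℂ) ^ n * ZMod.stdAddChar (t - symp a b) else 0 := by
    rw [pauli_mul hp, trace_pauli]
    by_cases hc : -b = c
    · subst hc
      rw [if_pos (add_neg_cancel b), if_pos rfl]
      congr 2
      simp only [symp_neg_right, symp_self]
      ring
    · rw [if_neg hc, if_neg fun h => hc (neg_eq_of_add_eq_zero_right h)]
  have hneg : -b ∈ sympComplement (linearComponent C) ↔ b ∈ sympComplement (linearComponent C) :=
    neg_mem_iff (H := sympComplementSubgroup (linearComponent C))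
  simp only [h, Finset.sum_ite_eq, Finset.mem_filter, Finset.mem_univ, true_and, hneg]

open Classical in
-- Each b in L^ω carries exactly one phase, so the code group has the order of L^ω, a power of p.
theorem codeProjector_eq {C : Set (Phase p n)} {a : Phase p n} (ha : a ∈ C) :
    ∃ r : ℕ, codeProjector C = ((p : ℂ) ^ r)⁻¹ •
      ∑ b : Phase p n with b ∈ sympComplement (linearComponent C), pauli (symp a b) b := by
  obtain ⟨r, hr⟩ := card_addSubgroup_eq_pow (p := p) (sympComplementSubgroup (linearComponent C))
  have hinj : Function.Injective fun b : Phase p n => (symp a b, b) :=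
    fun b c h => (Prod.ext_iff.1 h).2
  have hcard : (codeGroup C).ncard = p ^ r := by
    rw [codeGroup_eq_image ha, Set.ncard_image_of_injective _ hinj, ← hr]
    rfl
  refine ⟨r, ?_⟩
  rw [codeProjector, hcard, Nat.cast_pow]
  congr 1
  symm
  refine Finset.sum_bij (fun b _ => (symp a b, b)) ?_ (fun b _ c _ h => hinj h) ?_
    fun _ _ => rfl
  · intro b hb
    exact Finset.mem_filter.2 ⟨Finset.mem_univ _,
      (mem_codeGroup ha).2 ⟨(Finset.mem_filter.1 hb).2, rfl⟩⟩
  · rintro ⟨t, b⟩ hg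
    obtain ⟨hb, e⟩ := (mem_codeGroup ha).1 (Finset.mem_filter.1 hg).2
    exact ⟨b, Finset.mem_filter.2 ⟨Finset.mem_univ _, hb⟩, Prod.ext e.symm rfl⟩

open Classical in
-- Positivity enters through the factorisation FF†: the trace of π(t, b)J detects whether π(t, b)
-- fixes J, which happens exactly for b in L^ω and t = ω(a, b).
theorem isCode_of_wigner (hp : p ≠ 2) {κ : Type*} [Fintype κ] (F : Matrix (Reg p n) κ ℂ)
    {C : Set (Phase p n)} (hC : IsCoset C) {k : ℤ}
    (hJ : ∀ v, wigner (F * Fᴴ) v = if v ∈ C then (p : ℂ) ^ k else 0) : IsCode C (F * Fᴴ) := by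
  obtain rfl | ⟨a, ha⟩ := C.eq_empty_or_nonempty
  · have h0 : F * Fᴴ = 0 := by
      rw [eq_sum_wigner hp (F * Fᴴ)]
      simp [hJ]
    rw [h0]
    exact isCode_zero
  obtain ⟨d, hd⟩ := eq_smul_sum_pauli hp hC ha hJ
  obtain ⟨r, hr⟩ := codeProjector_eq ha
  have h2 := two_ne_zero_of_odd hp
  have hpz (d : ℤ) : (p : ℂ) ^ d ≠ 0 := zpow_ne_zero _ natCast_prime_ne_zero
  have htrace (t : ZMod p) (b : Phase p n) : (pauli t b * (F * Fᴴ)).trace =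
      if b ∈ sympComplement (linearComponent C) then
        (p : ℂ) ^ d * ((p : ℂ) ^ n * ZMod.stdAddChar (t - symp a b)) else 0 := by
    rw [hd, Matrix.mul_smul, Matrix.trace_smul, trace_pauli_mul_sum_pauli hp, smul_eq_mul,
      mul_ite, mul_zero]
  have hzero : 0 ∈ sympComplement (linearComponent C) :=
    zero_mem (sympComplementSubgroup (linearComponent C))
  have htr : (F * Fᴴ).trace = (p : ℂ) ^ d * (p : ℂ) ^ n := by
    have := htrace 0 0
    rwa [if_pos hzero, pauli_zero,
      AddChar.map_zero_eq_one, one_smul, Matrix.one_mul, symp_zero_right, sub_zero,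
      AddChar.map_zero_eq_one, mul_one] at this
  have htr0 : (F * Fᴴ).trace ≠ 0 := by
    rw [htr]; exact mul_ne_zero (hpz d) (pow_ne_zero _ natCast_prime_ne_zero)
  have hfix (t : ZMod p) (b : Phase p n) : pauli t b * (F * Fᴴ) = F * Fᴴ ↔
      b ∈ sympComplement (linearComponent C) ∧ t = symp a b := by
    constructor
    · intro h
      have h1 := htrace t b
      rw [h] at h1
      split_ifs at h1 with hb
      · refine ⟨hb, ?_⟩
        rw [htr, ← mul_assoc] at h1
        have h3 := mul_left_cancel₀ (htr ▸ htr0) ((mul_one _).trans h1)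
        rw [← AddChar.map_zero_eq_one (ZMod.stdAddChar (N := p))] at h3
        exact (sub_eq_zero.1 (ZMod.injective_stdAddChar h3).symm)
      · exact absurd h1 htr0
    · rintro ⟨hb, rfl⟩
      refine mul_eq_self_of_trace_eq
        (Matrix.mem_unitaryGroup_iff'.1 (pauli_mem_unitaryGroup hp _ b)) ?_
      rw [htrace, if_pos hb, htr, sub_self, AddChar.map_zero_eq_one, mul_one]
  have hstab : stabilisedSpace (F * Fᴴ) = C := by
    ext v
    constructor
    · intro hv
      have hvb {b : Phase p n} (hb : b ∈ sympComplement (linearComponent C)) :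
          symp a b = symp v b := hv _ b ((hfix _ b).2 ⟨hb, rfl⟩)
      -- If v agrees with a on L^ω, the Wigner sum at v counts the elements of L^ω up to a nonzero
      -- factor, contradicting its vanishing off C. This avoids computing a double complement.
      by_contra hvC
      have h1 := hJ v
      rw [if_neg hvC, hd, wigner_smul, wigner_sum, Finset.sum_congr rfl fun b hb => by
        rw [wigner_pauli hp, hvb (Finset.mem_filter.1 hb).2, sub_self,
          AddChar.map_zero_eq_one, mul_one], Finset.sum_const, nsmul_eq_mul] at h1
      refine mul_ne_zero (hpz d) (mul_ne_zero ?_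
        (inv_ne_zero (pow_ne_zero _ natCast_prime_ne_zero))) h1
      have : (Finset.univ.filter fun b : Phase p n =>
          b ∈ sympComplement (linearComponent C)).Nonempty :=
        ⟨0, Finset.mem_filter.2 ⟨Finset.mem_univ _, hzero⟩⟩
      exact_mod_cast this.card_pos.ne'
    · intro hv t b h
      obtain ⟨hb, rfl⟩ := (hfix t b).1 h
      exact symp_eq_of_mem ha hv hb
  refine ⟨hstab, ⟨d + r, ?_⟩, fun {g} hg => (hfix _ _).2 ((mem_codeGroup ha).1 hg), ?_, ?_⟩
  · rw [hr, smul_smul, zpow_add₀ natCast_prime_ne_zero, zpow_natCast, mul_assoc,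
      mul_inv_cancel₀ (pow_ne_zero _ natCast_prime_ne_zero), mul_one, hd]
  · intro c b hc hb
    rw [← hstab]
    intro t b' h
    obtain ⟨hb', rfl⟩ := (hfix t b').1 h
    have h1 := (hfix _ b).2 ⟨hb, rfl⟩
    suffices h0 : symp b b' = 0 by
      rw [symp_add_left, h0, add_zero, symp_eq_of_mem hc ha hb']
    -- The product of two stabilisers of J again fixes J, so its phase must be ω(a, b' + b); this
    -- forces the cocycle term ω(b', b)/2 to vanish.
    have h3 : pauli (symp a b) b * pauli (symp a b') b' * (F * Fᴴ) =
        pauli (symp a b') b' * pauli (symp a b) b * (F * Fᴴ) := by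
      rw [Matrix.mul_assoc, Matrix.mul_assoc, h, h1, h]
    rw [Matrix.mul_assoc, h, h1, pauli_mul hp, eq_comm, hfix, symp_add_right, symp_comm b'] at h3
    have h4 := h3.2
    field_simp at h4
    linear_combination h4
  · rw [Matrix.conjTranspose_mul, Matrix.conjTranspose_conjTranspose]

/-! ### The Löwner order on code projectors -/

namespace IsCode

variable {C D : Set (Phase p n)} {J K : Matrix (Reg p n) (Reg p n) ℂ}

theorem projector (h : IsCode C J) : IsCode C (codeProjector C) := by
  obtain ⟨d, hd⟩ := h.eq_smul
  have hpz : (p : ℂ) ^ d ≠ 0 := zpow_ne_zero _ natCast_prime_ne_zero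
  refine ⟨?_, ⟨0, by rw [zpow_zero, one_smul]⟩, fun {g} hg => ?_, h.add_mem, ?_⟩
  · refine Eq.trans ?_ h.stabilisedSpace_eq
    simp only [stabilisedSpace, hd, Matrix.mul_smul, smul_right_inj hpz]
  · have := h.pauli_mul_eq hg
    rwa [hd, Matrix.mul_smul, smul_right_inj hpz] at this
  · have := h.isHermitian
    rwa [hd, Matrix.conjTranspose_smul, star_zpow₀, star_natCast, smul_right_inj hpz] at this

theorem projector_mul_self (h : IsCode C J) : codeProjector C * codeProjector C = codeProjector C :=
  codeProjector_mul_eq_self fun _ hg => h.projector.pauli_mul_eq hg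

theorem projector_posSemidef (h : IsCode C J) : (codeProjector C).PosSemidef := by
  have := Matrix.posSemidef_conjTranspose_mul_self (codeProjector C)
  rwa [h.projector.isHermitian, h.projector_mul_self] at this

/-- A larger coset imposes more orthogonality. Nonemptiness matters: the group of the empty set
contains only scalars. -/
theorem codeGroup_subset (hne : C.Nonempty) (h : C ⊆ D) : codeGroup D ⊆ codeGroup C := by
  obtain ⟨a, ha⟩ := hne
  intro g hg
  obtain ⟨hb, e⟩ := (mem_codeGroup (h ha)).1 hg
  refine (mem_codeGroup ha).2 ⟨?_, e⟩
  rintro _ ⟨x, hx, y, hy, rfl⟩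
  exact hb _ ⟨x, h hx, y, h hy, rfl⟩

/-- For orthogonal projections, P ≤ Q amounts to QP = P. Then every stabiliser of Q stabilises P,
which gives C ⊆ D; conversely C ⊆ D reverses the inclusion of code groups, and averaging over the
smaller group fixes P. -/
theorem projector_le_iff (hJ : IsCode C J) (hK : IsCode D K) :
    codeProjector C ≤ codeProjector D ↔ C ⊆ D := by
  set P := codeProjector C with hP
  set Q := codeProjector D with hQ
  have hPP : P * P = P := hJ.projector_mul_self
  have hQQ : Q * Q = Q := hK.projector_mul_self
  have hPH : Pᴴ = P := hJ.projector.isHermitian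
  have hQH : Qᴴ = Q := hK.projector.isHermitian
  constructor
  · intro hle
    have hQA : (1 - Q)ᴴ = 1 - Q := by
      rw [Matrix.conjTranspose_sub, Matrix.conjTranspose_one, hQH]
    have h1 : ((1 - Q)ᴴ * (Q - P) * (1 - Q)).PosSemidef :=
      (Matrix.le_iff.1 hle).conjTranspose_mul_mul_same _
    -- Compressing to the complement of Q leaves minus a positive operator, so positivity forces P(1
    -- - Q) = 0.
    have h2 : (1 - Q)ᴴ * (Q - P) * (1 - Q) = 0 - (P * (1 - Q))ᴴ * (P * (1 - Q)) := by
      have e1 : (1 - Q) * Q = 0 := by rw [sub_mul, one_mul, hQQ, sub_self]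
      rw [Matrix.conjTranspose_mul, hQA, hPH]
      calc (1 - Q) * (Q - P) * (1 - Q) = ((1 - Q) * Q - (1 - Q) * P) * (1 - Q) := by
            rw [mul_sub (1 - Q) Q P]
        _ = 0 - (1 - Q) * (P * P) * (1 - Q) := by rw [e1, hPP, sub_mul, zero_mul]
        _ = _ := by simp only [mul_assoc]
    rw [h2] at h1
    have h3 : (P * (1 - Q))ᴴ * (P * (1 - Q)) = 0 :=
      le_antisymm (Matrix.le_iff.2 h1)
        (Matrix.nonneg_iff_posSemidef.2 (Matrix.posSemidef_conjTranspose_mul_self _))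
    rw [Matrix.conjTranspose_mul_self_eq_zero, mul_sub, mul_one, sub_eq_zero] at h3
    have h4 : P = Q * P := by
      have := congrArg Matrix.conjTranspose h3
      rwa [Matrix.conjTranspose_mul, hPH, hQH] at this
    rw [← hJ.projector.stabilisedSpace_eq, ← hK.projector.stabilisedSpace_eq, ← hP, ← hQ]
    intro v hv t b hb
    refine hv t b ?_
    rw [h4, ← mul_assoc, hb]
  · intro hCD
    obtain rfl | hne := C.eq_empty_or_nonempty
    · rw [hP, codeProjector_empty]
      exact Matrix.nonneg_iff_posSemidef.2 hK.projector_posSemidef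
    have h1 : Q * P = P := codeProjector_mul_eq_self fun _ hg =>
      hJ.projector.pauli_mul_eq (codeGroup_subset hne hCD hg)
    have h2 : P * Q = P := by
      have := congrArg Matrix.conjTranspose h1
      rwa [Matrix.conjTranspose_mul, hPH, hQH] at this
    -- With QP = PQ = P, the difference Q - P is its own square.
    have h3 := Matrix.posSemidef_conjTranspose_mul_self (Q - P)
    rw [Matrix.conjTranspose_sub, hPH, hQH, mul_sub, sub_mul, sub_mul, hQQ, h2, h1, hPP, sub_self,
      sub_zero] at h3
    exact Matrix.le_iff.2 h3

end IsCode

end StabTheory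

end

noncomputable section

namespace StabTheory

variable {p n m k : ℕ} [Fact p.Prime]

/-! ### Supports of flat functions -/

/-- All nonzero values are the same power of p, so nothing cancels. -/
theorem IsFlat.sum_ne_zero_iff {W : Type*} [AddCommGroup W] [Fintype W] {F : W → ℂ}
    (hF : IsFlat p F) : ∑ w, F w ≠ 0 ↔ ∃ w, F w ≠ 0 := by
  classical
  refine ⟨fun h => ?_, ?_⟩
  · by_contra! h0
    exact h (Finset.sum_eq_zero fun w _ => h0 w)
  · obtain ⟨k, C, -, h⟩ := hF
    have hk : (p : ℂ) ^ k ≠ 0 := zpow_ne_zero _ natCast_prime_ne_zero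
    rintro ⟨w, hw⟩
    have hwC : w ∈ C := by
      by_contra hwC
      exact hw (by rw [h, if_neg hwC])
    have hne : (Finset.univ.filter fun v => v ∈ C).Nonempty :=
      ⟨w, Finset.mem_filter.2 ⟨Finset.mem_univ _, hwC⟩⟩
    rw [Finset.sum_congr rfl fun v _ => h v, ← Finset.sum_filter, Finset.sum_const, nsmul_eq_mul]
    exact mul_ne_zero (by exact_mod_cast hne.card_pos.ne') hk

open Classical in
theorem IsFlat.exists_support {V : Type*} [AddCommGroup V] {F : V → ℂ} (hF : IsFlat p F) :
    ∃ (C : Set V) (k : ℤ), IsCoset C ∧ (∀ v, v ∈ C ↔ F v ≠ 0) ∧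
      ∀ v, F v = if v ∈ C then (p : ℂ) ^ k else 0 := by
  obtain ⟨k, C, hC, h⟩ := hF
  refine ⟨C, k, hC, fun v => ?_, h⟩
  rw [h]
  by_cases hv : v ∈ C
  · simp [hv, zpow_ne_zero k (natCast_prime_ne_zero (p := p))]
  · simp [hv]

/-! ## Transfer functions of doubled maps -/

/-- The linear map on operators with a given doubled matrix. -/
def superop (D : Matrix (Reg p m × Reg p m) (Reg p n × Reg p n) ℂ)
    (M : Matrix (Reg p n) (Reg p n) ℂ) : Matrix (Reg p m) (Reg p m) ℂ :=
  Matrix.of fun y y' => ∑ x, D (y, y') x * M x.1 x.2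

/-- The matrix elements of a linear map on operators with respect to phase point operators. -/
def cpTransfer (D : Matrix (Reg p m × Reg p m) (Reg p n × Reg p n) ℂ)
    (q : Phase p n × Phase p m) : ℂ :=
  wigner (superop D (phasePoint q.1)) q.2

theorem superop_mul (D : Matrix (Reg p k × Reg p k) (Reg p m × Reg p m) ℂ)
    (E : Matrix (Reg p m × Reg p m) (Reg p n × Reg p n) ℂ) (M : Matrix (Reg p n) (Reg p n) ℂ) :
    superop (D * E) M = superop D (superop E M) := by
  ext y y'
  simp only [superop, Matrix.of_apply, Matrix.mul_apply, Finset.sum_mul, Finset.mul_sum]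
  rw [Finset.sum_comm]
  exact Finset.sum_congr rfl fun _ _ => Finset.sum_congr rfl fun _ _ => mul_assoc _ _ _

theorem superop_sum_smul {ι : Type*} (s : Finset ι)
    (D : Matrix (Reg p m × Reg p m) (Reg p n × Reg p n) ℂ) (c : ι → ℂ)
    (M : ι → Matrix (Reg p n) (Reg p n) ℂ) :
    superop D (∑ i ∈ s, c i • M i) = ∑ i ∈ s, c i • superop D (M i) := by
  ext y y'
  simp only [superop, Matrix.of_apply, Matrix.sum_apply, Matrix.smul_apply, smul_eq_mul,
    Finset.mul_sum]
  rw [Finset.sum_comm]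
  exact Finset.sum_congr rfl fun _ _ => Finset.sum_congr rfl fun _ _ => by ring

theorem cpTransfer_mul (hp : p ≠ 2) (D : Matrix (Reg p k × Reg p k) (Reg p m × Reg p m) ℂ)
    (E : Matrix (Reg p m × Reg p m) (Reg p n × Reg p n) ℂ) (q : Phase p n × Phase p k) :
    cpTransfer (D * E) q = ∑ v, cpTransfer E (q.1, v) * cpTransfer D (v, q.2) := by
  rw [cpTransfer, superop_mul, eq_sum_wigner hp (superop E _), superop_sum_smul, wigner_sum]
  exact Finset.sum_congr rfl fun v _ => wigner_smul _ _ _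

/-- The identity on the environment is a uniform mixture of phase points, so discarding it becomes a
sum over its phase space. -/
theorem tensor_one_eq_sum (hp : p ≠ 2) (e : ℕ) (v : Phase p n) :
    tensor (phasePoint v) (1 : Matrix (Reg p e) (Reg p e) ℂ) =
      ((p : ℂ) ^ e)⁻¹ • ∑ s : Phase p e, phasePoint (Phase.append v s) := by
  refine matrix_ext_append fun i i' j j' => ?_
  have h := congrFun (congrFun (sum_phasePoint hp (n := e)) i') j'
  rw [Matrix.sum_apply, Matrix.smul_apply] at h
  simp only [phasePoint_append, Matrix.smul_apply, Matrix.sum_apply, tensor_append,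
    ← Finset.mul_sum, h, smul_eq_mul]
  have h0 : (p : ℂ) ^ e ≠ 0 := pow_ne_zero _ natCast_prime_ne_zero
  field_simp

theorem Pair.superop_double (f : Pair p n m) (M : Matrix (Reg p n) (Reg p n) ℂ) :
    superop f.double M =
      f.map * StabTheory.tensor M (1 : Matrix (Reg p f.env) (Reg p f.env) ℂ) * f.mapᴴ := by
  ext y y'
  simp only [superop, Matrix.of_apply, Pair.double_apply, Matrix.mul_apply, sum_append,
    tensor_append, Matrix.one_apply, mul_ite, mul_one, mul_zero,
    Fintype.sum_prod_type, Finset.sum_mul, Matrix.conjTranspose_apply]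
  calc _ = ∑ x, ∑ x', ∑ s, f.map y (Fin.append x s) * M x x' * star (f.map y' (Fin.append x' s)) :=
        Finset.sum_congr rfl fun _ _ => Finset.sum_congr rfl fun _ _ =>
          Finset.sum_congr rfl fun _ _ => by ring
    _ = _ := by
        rw [Finset.sum_comm]
        refine Finset.sum_congr rfl fun x' _ => ?_
        rw [Finset.sum_comm]
        refine Finset.sum_congr rfl fun t _ => Finset.sum_congr rfl fun x _ => ?_
        simp only [ite_mul, zero_mul, Finset.sum_ite_eq', Finset.mem_univ, if_true]

theorem Pair.isFlat_cpTransfer (hp : p ≠ 2) (f : Pair p n m) : IsFlat p (cpTransfer f.double) := by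
  have e : cpTransfer f.double = fun q => (p : ℂ) ^ (-f.env : ℤ) *
      ∑ s : Phase p f.env, transfer f.map (Phase.append q.1 s, q.2) := by
    funext q
    rw [cpTransfer, Pair.superop_double, tensor_one_eq_sum hp, Matrix.mul_smul, Matrix.smul_mul,
      Matrix.mul_sum, Matrix.sum_mul, wigner_smul, wigner_sum, zpow_neg, zpow_natCast]
    rfl
  rw [e]
  refine IsFlat.zpow_mul (IsFlat.sum
    (F := fun r : (Phase p n × Phase p m) × Phase p f.env =>
      transfer f.map (phaseAppend n f.env (r.1.1, r.2), r.1.2)) ?_) _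
  exact (isFlat_transfer hp f.isStab).comp_hom
    (((phaseAppend n f.env).comp (((AddMonoidHom.fst (Phase p n) (Phase p m)).comp
      (AddMonoidHom.fst _ (Phase p f.env))).prod (AddMonoidHom.snd _ _))).prod
      ((AddMonoidHom.snd (Phase p n) (Phase p m)).comp (AddMonoidHom.fst _ (Phase p f.env))))

namespace CPMStab

variable {X Y Z : CPMStab p}

theorem isFlat_cpTransfer (hp : p ≠ 2) (f : X ⟶ Y) : IsFlat p (cpTransfer (double f)) := by
  induction f using Quotient.inductionOn with
  | h f => exact Pair.isFlat_cpTransfer hp f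

/-- Kraus form: F is the underlying stabiliser map with its input bent into the rows and its
environment as columns. -/
theorem exists_choi_eq (f : X ⟶ Y) : ∃ (e : ℕ)
    (F : Matrix (Reg p (X.qupits + Y.qupits)) (Reg p e) ℂ), choi f = F * Fᴴ := by
  induction f using Quotient.inductionOn with
  | h f => exact ⟨f.env, Matrix.of fun u s =>
      f.map (u ∘ Fin.natAdd X.qupits) (Fin.append (u ∘ Fin.castAdd Y.qupits) s), rfl⟩

theorem choi_append (f : X ⟶ Y) (x x' : Reg p X.qupits) (y y' : Reg p Y.qupits) :
    choi f (Fin.append x y) (Fin.append x' y') = double f (y, y') (x, x') := by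
  have h1 (x : Reg p X.qupits) (y : Reg p Y.qupits) :
      Fin.append x y ∘ Fin.castAdd Y.qupits = x := funext fun i => Fin.append_left x y i
  have h2 (x : Reg p X.qupits) (y : Reg p Y.qupits) :
      Fin.append x y ∘ Fin.natAdd X.qupits = y := funext fun i => Fin.append_right x y i
  simp only [choi, Matrix.of_apply, h1, h2]

/-- The input leg of the Choi matrix is transposed, hence conjugated in phase space; the power of p
is the extra Wigner normalisation on that leg. -/
theorem wigner_choi (f : X ⟶ Y) (z : Phase p (X.qupits + Y.qupits)) :
    wigner (choi f) z = (p : ℂ) ^ (-X.qupits : ℤ) *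
      cpTransfer (double f) ((phaseFst _ _ z).conj, phaseSnd _ _ z) := by
  conv_lhs => rw [← phase_append_fst_snd z]
  rw [cpTransfer, wigner, wigner, phasePoint_append, ← phasePoint_transpose, ← mul_assoc,
    zpow_neg, zpow_natCast, ← mul_inv, ← pow_add]
  congr 1
  simp only [Matrix.trace, Matrix.diag_apply, Matrix.mul_apply, sum_append, tensor_append,
    choi_append, superop, Matrix.of_apply, Matrix.transpose_apply, Fintype.sum_prod_type,
    Finset.mul_sum]
  rw [Finset.sum_comm]
  refine Finset.sum_congr rfl fun y _ => ?_
  calc _ = ∑ x, ∑ y', ∑ x', phasePoint (phaseFst _ _ z) x x' * phasePoint (phaseSnd _ _ z) y y' *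
        double f (y', y) (x', x) := Finset.sum_congr rfl fun _ _ => Finset.sum_comm
    _ = ∑ y', ∑ x, ∑ x', phasePoint (phaseFst _ _ z) x x' * phasePoint (phaseSnd _ _ z) y y' *
        double f (y', y) (x', x) := Finset.sum_comm
    _ = _ := by
        refine Finset.sum_congr rfl fun y' _ => ?_
        rw [Finset.sum_comm]
        exact Finset.sum_congr rfl fun _ _ => Finset.sum_congr rfl fun _ _ => by ring

/-! ### Names and the relation of a morphism -/

theorem mem_nameOf_iff {n m : ℕ} {R : Set (Phase p n × Phase p m)} {z : Phase p (n + m)} :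
    z ∈ nameOf R ↔ ((phaseFst _ _ z).conj, phaseSnd _ _ z) ∈ R := by
  constructor
  · rintro ⟨q, hq, rfl⟩
    simpa only [phaseFst_append, phaseSnd_append, phase_conj_conj] using hq
  · intro h
    refine ⟨_, h, ?_⟩
    simp only [phase_conj_conj, phase_append_fst_snd]

theorem append_mem_nameOf_iff {n m : ℕ} {R : Set (Phase p n × Phase p m)}
    {q : Phase p n × Phase p m} : Phase.append q.1.conj q.2 ∈ nameOf R ↔ q ∈ R := by
  rw [mem_nameOf_iff, phaseFst_append, phaseSnd_append, phase_conj_conj]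

theorem nameOf_subset_iff {n m : ℕ} {R S : Set (Phase p n × Phase p m)} :
    nameOf R ⊆ nameOf S ↔ R ⊆ S :=
  ⟨fun h _ hq => append_mem_nameOf_iff.1 (h (append_mem_nameOf_iff.2 hq)), Set.image_mono⟩

theorem exists_isCode_choi (hp : p ≠ 2) (f : X ⟶ Y) :
    ∃ C, IsCoset C ∧ (∀ q, q ∈ C ↔ cpTransfer (double f) q ≠ 0) ∧
      IsCode (nameOf C) (choi f) := by
  classical
  obtain ⟨C, k, hC, hmem, h⟩ := (isFlat_cpTransfer hp f).exists_support
  obtain ⟨e, F, hF⟩ := exists_choi_eq f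
  have hC' : IsCoset (nameOf C) := by
    have := hC.preimage (((phaseConj _).comp (phaseFst X.qupits Y.qupits)).prod (phaseSnd _ _))
    convert this using 1
    ext z
    exact mem_nameOf_iff
  refine ⟨C, hC, hmem, ?_⟩
  rw [hF]
  refine isCode_of_wigner hp F hC' (k := -X.qupits + k) fun z => ?_
  rw [← hF, wigner_choi, h, zpow_add₀ natCast_prime_ne_zero, mul_ite, mul_zero]
  exact if_congr mem_nameOf_iff.symm rfl rfl

theorem rel_eq_of_isCode {f : X ⟶ Y} {C : Set (Phase p X.qupits × Phase p Y.qupits)}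
    (h : IsCode (nameOf C) (choi f)) : rel f = C := by
  ext q
  change Phase.append q.1.conj q.2 ∈ stabilisedSpace (choi f) ↔ _
  rw [h.stabilisedSpace_eq, append_mem_nameOf_iff]

/-- This replaces the definition through stabilisers of the Choi matrix by one that is computable
for composites. -/
theorem mem_rel_iff (hp : p ≠ 2) {f : X ⟶ Y} {q : Phase p X.qupits × Phase p Y.qupits} :
    q ∈ rel f ↔ cpTransfer (double f) q ≠ 0 := by
  obtain ⟨C, -, hmem, h⟩ := exists_isCode_choi hp f
  rw [rel_eq_of_isCode h, hmem]

theorem isCode_choi (hp : p ≠ 2) (f : X ⟶ Y) : IsCode (nameOf (rel f)) (choi f) := by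
  obtain ⟨C, -, -, h⟩ := exists_isCode_choi hp f
  rwa [rel_eq_of_isCode h]

theorem isCoset_rel (hp : p ≠ 2) (f : X ⟶ Y) : IsCoset (rel f) := by
  obtain ⟨C, hC, -, h⟩ := exists_isCode_choi hp f
  rwa [rel_eq_of_isCode h]

theorem exists_choi_eq_zpow_smul (hp : p ≠ 2) (f : X ⟶ Y) :
    ∃ d : ℤ, choi f = (p : ℂ) ^ d • projector f := (isCode_choi hp f).eq_smul

theorem isAffineCoisotropic_rel (hp : p ≠ 2) (f : X ⟶ Y) : IsAffineCoisotropic (rel f) := by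
  have hC := isCoset_rel hp f
  refine ⟨hC.toAffineSubspace, rfl, ?_⟩
  rintro ⟨q, hq⟩ v hv
  have hconj (a b : Phase p X.qupits) : (a - b).conj = a.conj - b.conj :=
    map_sub (phaseConj _) a b
  -- Conjugating the input carries -ω ⊕ ω to the standard form, so orthogonality to the direction
  -- becomes orthogonality to the name; `IsCode.add_mem` then keeps the translate of q by v in the
  -- relation.
  have hmem : Phase.append (Phase.conj v.1) v.2 ∈ sympComplement (linearComponent (nameOf (rel f))) := by
    rintro _ ⟨_, ⟨x, hx, rfl⟩, _, ⟨y, hy, rfl⟩, rfl⟩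
    have h1 : Phase.append x.1.conj x.2 - Phase.append y.1.conj y.2 =
        Phase.append (x - y).1.conj (x - y).2 := by
      rw [Prod.fst_sub, Prod.snd_sub, hconj]
      exact (map_sub (phaseAppend _ _) (x.1.conj, x.2) (y.1.conj, y.2)).symm
    rw [h1, symp_append, symp_conj]
    exact hv _ (AffineSubspace.vsub_mem_direction (s := hC.toAffineSubspace (p := p)) hx hy)
  have h2 := (isCode_choi hp f).add_mem (append_mem_nameOf_iff.2 hq) hmem
  have h3 : Phase.append q.1.conj q.2 + Phase.append (Phase.conj v.1) v.2 =
      Phase.append (q + v).1.conj (q + v).2 := by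
    rw [← phase_append_add, Prod.fst_add, Prod.snd_add]
    congr 1
    exact (map_add (phaseConj _) q.1 v.1).symm
  rw [h3, append_mem_nameOf_iff] at h2
  have h4 := AffineSubspace.vsub_mem_direction (s := hC.toAffineSubspace (p := p)) h2 hq
  rwa [vsub_eq_sub, add_sub_cancel_left] at h4

/-! ### Inclusion of relations and monotonicity of composition -/

theorem loewnerLE_iff (hp : p ≠ 2) (f g : X ⟶ Y) : loewnerLE f g ↔ rel f ⊆ rel g :=
  ((isCode_choi hp f).projector_le_iff (isCode_choi hp g)).trans nameOf_subset_iff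

/-- The transfer function of a composite is a sum of flat terms over the middle phase space; absence
of cancellation makes its support the relational composite. -/
theorem mem_rel_comp_iff (hp : p ≠ 2) {f : X ⟶ Y} {g : Y ⟶ Z}
    {q : Phase p X.qupits × Phase p Z.qupits} :
    q ∈ rel (f ≫ g) ↔ ∃ v, (q.1, v) ∈ rel f ∧ (v, q.2) ∈ rel g := by
  have hflat : IsFlat p fun v =>
      cpTransfer (double f) (q.1, v) * cpTransfer (double g) (v, q.2) := by
    obtain ⟨k, C, hC, hf⟩ := isFlat_cpTransfer hp f
    obtain ⟨l, D, hD, hg⟩ := isFlat_cpTransfer hp g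
    refine IsFlat.mul ⟨k, {v | (q.1, v) ∈ C}, ?_, fun v => hf _⟩
      ⟨l, {v | (v, q.2) ∈ D}, ?_, fun v => hg _⟩
    · intro x hx y hy z hz
      have := hC _ hx _ hy _ hz
      simpa using this
    · intro x hx y hy z hz
      have := hD _ hx _ hy _ hz
      simpa using this
  rw [mem_rel_iff hp, double_comp, cpTransfer_mul hp, hflat.sum_ne_zero_iff]
  exact exists_congr fun v => by rw [mul_ne_zero_iff, mem_rel_iff hp, mem_rel_iff hp]

theorem rel_comp_mono (hp : p ≠ 2) {f f' : X ⟶ Y} {g g' : Y ⟶ Z} (hf : rel f ⊆ rel f')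
    (hg : rel g ⊆ rel g') : rel (f ≫ g) ⊆ rel (f' ≫ g') := by
  intro q hq
  obtain ⟨v, h1, h2⟩ := (mem_rel_comp_iff hp).1 hq
  exact (mem_rel_comp_iff hp).2 ⟨v, hf h1, hg h2⟩

theorem isPreorderEnrichment (hp : p ≠ 2) : IsPreorderEnrichment (CPMStab p) loewnerLE where
  refl _ := le_refl _
  trans _ _ _ := le_trans
  comp f f' g g' hf hg := by
    rw [loewnerLE_iff hp] at hf hg ⊢
    exact rel_comp_mono hp hf hg

theorem choi_injective {f g : X ⟶ Y} (h : choi f = choi g) : f = g := by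
  refine double_injective ?_
  ext ⟨y, y'⟩ ⟨x, x'⟩
  rw [← choi_append, h, choi_append]

theorem choi_scale (l : unit p ⟶ unit p) (f : X ⟶ Y) :
    choi (scale l f) = double l 0 0 • choi f := by
  ext u u'
  simp [choi, double_scale]

/-! ## Invertible scalars -/

/-- Doubling squares the modulus of a scalar, so powers of √p realise every integer power of p in
CPM(Stab_p), including the inverses. -/
theorem exists_isStab_sqrt_zpow (p : ℕ) [Fact p.Prime] (d : ℤ) : ∃ c : ℂ,
    IsStab (p := p) (n := 0) (m := 0) (c • 1) ∧ c * star c = (p : ℂ) ^ d := by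
  have hp0 : (p : ℂ) ≠ 0 := natCast_prime_ne_zero
  induction d using Int.induction_on with
  | zero => exact ⟨1, by rw [one_smul]; exact isStab_one 0, by simp⟩
  | succ d ih =>
    obtain ⟨c, hc, e⟩ := ih
    refine ⟨c * ((Real.sqrt p : ℝ) : ℂ), ?_, ?_⟩
    · have := hc.comp _ _ IsStab.sqrt
      rwa [Matrix.smul_mul, Matrix.one_mul, smul_smul] at this
    · rw [star_mul', mul_mul_mul_comm, e, RCLike.star_def, Complex.conj_ofReal,
        ← Complex.ofReal_mul, Real.mul_self_sqrt (Nat.cast_nonneg _), zpow_add₀ hp0, zpow_one,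
        Complex.ofReal_natCast]
  | pred d ih =>
    obtain ⟨c, hc, e⟩ := ih
    refine ⟨c * (((Real.sqrt p)⁻¹ : ℝ) : ℂ), ?_, ?_⟩
    · have := hc.comp _ _ IsStab.invSqrt
      rwa [Matrix.smul_mul, Matrix.one_mul, smul_smul] at this
    · rw [star_mul', mul_mul_mul_comm, e, RCLike.star_def, Complex.conj_ofReal,
        ← Complex.ofReal_mul, ← mul_inv, Real.mul_self_sqrt (Nat.cast_nonneg _),
        zpow_sub₀ hp0, zpow_one, Complex.ofReal_inv, Complex.ofReal_natCast, div_eq_mul_inv]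

theorem exists_scalar (p : ℕ) [Fact p.Prime] (d : ℤ) :
    ∃ l : unit p ⟶ unit p, double l 0 0 = (p : ℂ) ^ d := by
  obtain ⟨c, hc, e⟩ := exists_isStab_sqrt_zpow p d
  refine ⟨Quotient.mk _ (Pair.pure _ hc), ?_⟩
  change (Pair.pure _ hc).double 0 0 = _
  rw [Pair.double_apply]
  refine (Fintype.sum_subsingleton (ι := Reg p 0) _ 0).trans ?_
  rw [← e]
  simp only [Pair.pure, Matrix.smul_apply, smul_eq_mul]
  rw [Matrix.one_apply, Matrix.one_apply, if_pos (Subsingleton.elim _ _),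
    if_pos (Subsingleton.elim _ _), mul_one]

theorem scalar_ext {l m : unit p ⟶ unit p} (h : double l 0 0 = double m 0 0) : l = m := by
  refine double_injective ?_
  ext y x
  rw [Subsingleton.elim y 0, Subsingleton.elim x 0, h]

theorem exists_isIso_scalar (p : ℕ) [Fact p.Prime] (d : ℤ) :
    ∃ l : unit p ⟶ unit p, IsIso l ∧ double l 0 0 = (p : ℂ) ^ d := by
  obtain ⟨l, hl⟩ := exists_scalar p d
  obtain ⟨m, hm⟩ := exists_scalar p (-d)
  have hp0 : (p : ℂ) ≠ 0 := natCast_prime_ne_zero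
  refine ⟨l, ⟨m, scalar_ext ?_, scalar_ext ?_⟩, hl⟩
  · rw [double_scalar_comp, double_scalar_id, hl, hm, ← zpow_add₀ hp0, add_neg_cancel, zpow_zero]
  · rw [double_scalar_comp, double_scalar_id, hl, hm, ← zpow_add₀ hp0, neg_add_cancel, zpow_zero]

/-- Both Choi matrices are powers of p times the same projector, and the ratio of the powers is an
invertible scalar. -/
theorem exists_scale_eq (hp : p ≠ 2) {f g : X ⟶ Y} (h : projector f = projector g) :
    ∃ l : unit p ⟶ unit p, IsIso l ∧ g = scale l f := by
  obtain ⟨c, hc⟩ := exists_choi_eq_zpow_smul hp f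
  obtain ⟨d, hd⟩ := exists_choi_eq_zpow_smul hp g
  obtain ⟨l, hl, e⟩ := exists_isIso_scalar p (d - c)
  refine ⟨l, hl, choi_injective ?_⟩
  rw [choi_scale, e, hc, smul_smul, ← zpow_add₀ natCast_prime_ne_zero, sub_add_cancel, h, hd]

/-! ## Causal morphisms -/

theorem double_trace_apply (X : CPMStab p) (x x' : Reg p X.qupits) (y : Reg p 0 × Reg p 0) :
    double (trace X) y (x, x') = if x = x' then 1 else 0 := by
  change (Pair.trace p X.qupits).double y (x, x') = _
  rw [Pair.double_apply]
  simp only [Pair.trace, Matrix.conjTranspose_apply, cup_append]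
  simpa [eq_comm] using fun h => absurd (Finset.mem_univ _) h

theorem trace_choi (f : X ⟶ Y) :
    (choi f).trace = ∑ x, double (f ≫ trace Y) 0 (x, x) := by
  simp only [Matrix.trace, Matrix.diag_apply, sum_append, choi_append, double_comp,
    Matrix.mul_apply, Fintype.sum_prod_type, double_trace_apply, ite_mul, one_mul, zero_mul,
    Finset.sum_ite_eq, Finset.mem_univ, if_true]

theorem trace_choi_of_causal {f : X ⟶ Y} (hf : f ≫ trace Y = trace X) :
    (choi f).trace = (p : ℂ) ^ X.qupits := by
  rw [trace_choi, hf]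
  simp only [double_trace_apply, if_true]
  simp [ZMod.card]

/-- Causality fixes the trace of the Choi matrix at a nonzero value depending only on the source,
leaving no freedom in the scalar factor. -/
theorem eq_of_causal (hp : p ≠ 2) {f g : X ⟶ Y} (hf : f ≫ trace Y = trace X)
    (hg : g ≫ trace Y = trace X) (h : projector f = projector g) : f = g := by
  obtain ⟨c, hc⟩ := exists_choi_eq_zpow_smul hp f
  obtain ⟨d, hd⟩ := exists_choi_eq_zpow_smul hp g
  have h0 : (p : ℂ) ^ X.qupits ≠ 0 := pow_ne_zero _ natCast_prime_ne_zero
  have hf' := trace_choi_of_causal hf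
  have hg' := trace_choi_of_causal hg
  rw [hc, Matrix.trace_smul, smul_eq_mul] at hf'
  rw [hd, ← h, Matrix.trace_smul, smul_eq_mul, ← hf'] at hg'
  have h1 : (projector f).trace ≠ 0 := by
    intro h1
    rw [h1, mul_zero] at hf'
    exact h0 hf'.symm
  refine choi_injective ?_
  rw [hc, hd, h, mul_right_cancel₀ h1 hg']

end CPMStab

/-! ### Enrichment of the projective and causal categories -/

namespace ProjCPMStab

theorem loewnerLE_iff (hp : p ≠ 2) {X Y : ProjCPMStab p} (f g : X ⟶ Y) :
    loewnerLE f g ↔ rel f ⊆ rel g := by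
  induction f using Quotient.inductionOn with
  | h f =>
  induction g using Quotient.inductionOn with
  | h g => exact CPMStab.loewnerLE_iff hp f g

theorem isPartialOrderEnrichment (hp : p ≠ 2) :
    IsPartialOrderEnrichment (ProjCPMStab p) loewnerLE where
  refl _ := le_refl _
  trans _ _ _ := le_trans
  comp f f' g g' := by
    induction f using Quotient.inductionOn with
    | h f =>
    induction f' using Quotient.inductionOn with
    | h f' =>
    induction g using Quotient.inductionOn with
    | h g =>
    induction g' using Quotient.inductionOn with
    | h g' => exact (CPMStab.isPreorderEnrichment hp).comp f f' g g'
  antisymm {X Y} f g := by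
    induction f using Quotient.inductionOn with
    | h f =>
    induction g using Quotient.inductionOn with
    | h g =>
      intro h h'
      exact Quotient.sound (s := projSetoid X.base Y.base)
        (CPMStab.exists_scale_eq hp (le_antisymm h h'))

end ProjCPMStab

theorem CausCPMStab.isPartialOrderEnrichment (hp : p ≠ 2) :
    IsPartialOrderEnrichment (CausCPMStab p) CausCPMStab.loewnerLE where
  refl _ := le_refl _
  trans _ _ _ := le_trans
  comp f f' g g' := (CPMStab.isPreorderEnrichment hp).comp f.hom f'.hom g.hom g'.hom
  antisymm f g h h' := by
    refine WideSubcategory.hom_ext _ ?_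
    exact CPMStab.eq_of_causal hp f.property g.property (le_antisymm h h')

end StabTheory

end

theorem mainTheorem8 (p : ℕ) [Fact p.Prime] (hp : p ≠ 2) :
    (∀ (X Y : CPMStab p) (f : X ⟶ Y),
      IsAffineCoisotropic (CPMStab.rel f) ∧
      ∃ c : ℝ, 0 < c ∧ CPMStab.choi f = (c : ℂ) • CPMStab.projector f) ∧
    (IsPreorderEnrichment (CPMStab p) CPMStab.loewnerLE ∧
      ∀ (X Y : CPMStab p) (f g : X ⟶ Y),
        CPMStab.loewnerLE f g ↔ CPMStab.rel f ⊆ CPMStab.rel g) ∧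
    (IsPartialOrderEnrichment (ProjCPMStab p) ProjCPMStab.loewnerLE ∧
      ∀ (X Y : ProjCPMStab p) (f g : X ⟶ Y),
        ProjCPMStab.loewnerLE f g ↔ ProjCPMStab.rel f ⊆ ProjCPMStab.rel g) ∧
    (IsPartialOrderEnrichment (CausCPMStab p) CausCPMStab.loewnerLE ∧
      ∀ (X Y : CausCPMStab p) (f g : X ⟶ Y),
        CausCPMStab.loewnerLE f g ↔ CPMStab.rel f.hom ⊆ CPMStab.rel g.hom) := by
  refine ⟨fun X Y f => ⟨CPMStab.isAffineCoisotropic_rel hp f, ?_⟩,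
    ⟨CPMStab.isPreorderEnrichment hp, fun X Y => CPMStab.loewnerLE_iff hp⟩,
    ⟨ProjCPMStab.isPartialOrderEnrichment hp, fun X Y => ProjCPMStab.loewnerLE_iff hp⟩,
    ⟨CausCPMStab.isPartialOrderEnrichment hp,
      fun X Y f g => CPMStab.loewnerLE_iff hp f.hom g.hom⟩⟩
  obtain ⟨d, hd⟩ := CPMStab.exists_choi_eq_zpow_smul hp f
  refine ⟨(p : ℝ) ^ d, zpow_pos (by exact_mod_cast (Fact.out : p.Prime).pos) d, ?_⟩
  rw [hd, Complex.ofReal_zpow, Complex.ofReal_natCast]
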